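/- Let $E$ be a finite-dimensional complex Hilbert space and $\mathcal L(E)$ the algebra of linear operators on $E$. For $V=E$ or $V=\mathcal L(E)$ let $L^2(V)$ be the space of square integrable $V$-valued functions on the unit circle $\mathbb T$ (normalised Lebesgue measure), and $H^2(V)\subset L^2(V)$ the subspace of functions whose Fourier coefficients of negative index vanish; $L^2(\mathcal L(E))$ carries the inner product coming from the Hilbert–Schmidt inner product on $\mathcal L(E)$. For $\Psi\in L^2(\mathcal L(E))$, $\Psi^*$ is the pointwise adjoint. Let $\Theta_1,\Theta_2\in H^\infty(\mathcal L(E))$ be pure inner functions, that is, nonconstant, isometric a.e. on $\mathbb T$, and with $\|\Theta_j(0)\|<1$. Put $$K_{\Theta_j}=H^2(E)\ominus\Theta_jH^2(E),\qquad \mathcal M_{\Theta_j}=H^2(\mathcal L(E))\ominus\Theta_jH^2(\mathcal L(E)),\qquad k_0^{\Theta_j}(z)=I-\Theta_j(z)\Theta_j(0)^*,$$ and let $P_{\Theta_j}$ be the orthogonal projection onto $K_{\Theta_j}$. For $\Phi\in L^2(\mathcal L(E))$ and a bounded operator $A:K_{\Theta_1}\to K_{\Theta_2}$ write $A=A_\Phi$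 if $Af=P_{\Theta_2}(\Phi f)$ for every essentially bounded $f\in K_{\Theta_1}$, and let $\mathcal T(\Theta_1,\Theta_2)$ be the set of all bounded operators $A: K_{\Theta_1}\to K_{\Theta_2}$ such that $A=A_\Phi$ for some $\Phi\in L^2(\mathcal L(E))$. Let $A\in\mathcal T(\Theta_1,\Theta_2)$. Then: (1) There exist $\Psi_1\in\mathcal M_{\Theta_2}$ and $\Psi_2\in\mathcal M_{\Theta_1}$ such that $A=A_{\Psi_1+\Psi_2^*}$. (2) If $\Psi_1\in\mathcal M_{\Theta_2}$, $\Psi_2\in\mathcal M_{\Theta_1}$ is one such pair, then the pairs $\Psi_1'\in\mathcal M_{\Theta_2}$, $\Psi_2'\in\mathcal M_{\Theta_1}$ with $A=A_{\Psi_1'+\Psi_2'^*}$ are exactly the pairs $$\Psi_1'=\Psi_1+k_0^{\Theta_2}X,\qquad \Psi_2'=\Psi_2-k_0^{\Theta_1}X^*,\qquad X\in\mathcal L(E).$$ -/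

import Mathlib

open MeasureTheory AddCircle
open scoped ENNReal InnerProductSpace

namespace AsymTTO

noncomputable section

instance factTwoPiPos : Fact (0 < 2 * Real.pi) := ⟨Real.two_pi_pos⟩

/-- The unit circle, parametrised by `t ∈ ℝ / 2πℤ` through `e^{it}`. -/
abbrev Torus : Type := AddCircle (2 * Real.pi)

/-- Normalised Lebesgue measure `dt / 2π`. -/
abbrev leb : Measure Torus := haarAddCircle

/-- `L^p(V)` on the circle. -/
abbrev LpT (p : ℝ≥0∞) (V : Type*) [NormedAddCommGroup V] := Lp V p leb

section Hardy

variable (V : Type*) [NormedAddCommGroup V] [NormedSpace ℂ V]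

lemma fourierCoeff_eq_integral_holder (n : ℤ) (f : LpT 2 V) :
    fourierCoeff (T := 2 * Real.pi) f n =
      ∫ t, ((ContinuousLinearMap.lsmul ℂ ℂ (E := V)).holder 1
        (fourierLp (T := 2 * Real.pi) 2 (-n)) f : LpT 1 V) t ∂leb := by
  unfold fourierCoeff
  refine integral_congr_ae ?_
  filter_upwards [(ContinuousLinearMap.lsmul ℂ ℂ (E := V)).coeFn_holder (r := 1)
    (fourierLp (T := 2 * Real.pi) 2 (-n)) f, coeFn_fourierLp (T := 2 * Real.pi) 2 (-n)]
    with t h1 h2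
  rw [h1, h2]
  rfl

/-- The `n`-th Fourier coefficient as a linear map on `L²(V)`. -/
def coeffₗ (n : ℤ) : LpT 2 V →ₗ[ℂ] V where
  toFun f := fourierCoeff (T := 2 * Real.pi) f n
  map_add' f g := by
    simp only [fourierCoeff_eq_integral_holder, ContinuousLinearMap.holder_add_right]
    rw [← integral_add (L1.integrable_coeFn _) (L1.integrable_coeFn _)]
    exact integral_congr_ae (Lp.coeFn_add _ _)
  map_smul' c f := by
    simp only [fourierCoeff_eq_integral_holder, ContinuousLinearMap.holder_smul_right,
      RingHom.id_apply]
    rw [← integral_smul]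
    exact integral_congr_ae (Lp.coeFn_smul _ _)

lemma continuous_coeffₗ (n : ℤ) : Continuous (coeffₗ V n) := by
  have h : (coeffₗ V n : LpT 2 V → V) = fun f => ∫ t,
      ((ContinuousLinearMap.lsmul ℂ ℂ (E := V)).holderL leb 2 2 1
        (fourierLp (T := 2 * Real.pi) 2 (-n)) f : LpT 1 V) t ∂leb := by
    funext f
    exact fourierCoeff_eq_integral_holder V n f
  rw [h]
  exact continuous_integral.comp (ContinuousLinearMap.continuous _)

/-- `H²(V)`: the functions of `L²(V)` whose Fourier coefficients of negative index vanish. -/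
def hardy : Submodule ℂ (LpT 2 V) :=
  ⨅ n : {n : ℤ // n < 0}, LinearMap.ker (coeffₗ V n)

variable {V} in
lemma mem_hardy {f : LpT 2 V} :
    f ∈ hardy V ↔ ∀ n : ℤ, n < 0 → fourierCoeff (T := 2 * Real.pi) f n = 0 := by
  simp [hardy, coeffₗ]

lemma isClosed_hardy : IsClosed (hardy V : Set (LpT 2 V)) := by
  rw [hardy, Submodule.coe_iInf]
  exact isClosed_iInter fun n => isClosed_singleton.preimage (continuous_coeffₗ V n)

end Hardy

variable {E : Type*} [NormedAddCommGroup E] [InnerProductSpace ℂ E] [FiniteDimensional ℂ E]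
  [CompleteSpace E]

/-- The value at the origin of (the analytic extension to the disc of) `Θ`, which is its
Fourier coefficient of index `0`. -/
def valueZero (Θ : LpT ∞ (E →L[ℂ] E)) : E →L[ℂ] E :=
  fourierCoeff (T := 2 * Real.pi) Θ 0

/-- `Θ ∈ H^∞(L(E))` is inner: it is nonconstant, and an isometry a.e. on the circle. -/
structure IsInner (Θ : LpT ∞ (E →L[ℂ] E)) : Prop where
  analytic : ∀ n : ℤ, n < 0 → fourierCoeff (T := 2 * Real.pi) Θ n = 0
  nonconstant : ¬ ∃ C : E →L[ℂ] E, ∀ᵐ t ∂leb, Θ t = C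
  isometry : ∀ᵐ t ∂leb, Isometry (Θ t)

/-- `Θ` is pure. -/
def IsPure (Θ : LpT ∞ (E →L[ℂ] E)) : Prop := ‖valueZero Θ‖ < 1

/-- The operator `f ↦ Θ f` on `L²(E)`, for `Θ ∈ L^∞(L(E))`. -/
def mulL (Θ : LpT ∞ (E →L[ℂ] E)) : LpT 2 E →L[ℂ] LpT 2 E :=
  (ContinuousLinearMap.id ℂ (E →L[ℂ] E)).holderL leb ∞ 2 2 Θ

/-- The model space `K_Θ = H²(E) ⊖ Θ H²(E)`. -/
def modelSpace (Θ : LpT ∞ (E →L[ℂ] E)) : Submodule ℂ (LpT 2 E) :=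
  hardy E ⊓ ((hardy E).map (mulL Θ).toLinearMap)ᗮ

instance completeSpace_modelSpace (Θ : LpT ∞ (E →L[ℂ] E)) :
    CompleteSpace (modelSpace Θ) := by
  have h : IsClosed (modelSpace Θ : Set (LpT 2 E)) := by
    rw [modelSpace, Submodule.coe_inf]
    exact (isClosed_hardy E).inter (Submodule.isClosed_orthogonal _)
  exact h.completeSpace_coe

/-- The product `Φ f ∈ L²(E)` of `Φ ∈ L²(L(E))` and an essentially bounded `f`. -/
def symbolMul (Φ : LpT 2 (E →L[ℂ] E)) (f : LpT ∞ E) : LpT 2 E :=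
  (ContinuousLinearMap.id ℂ (E →L[ℂ] E)).holder 2 Φ f

/-- `A = A_Φ^{Θ₁,Θ₂}`: the bounded operator `A : K_{Θ₁} → K_{Θ₂}` satisfies
`A f = P_{Θ₂} (Φ f)` for all `f ∈ K_{Θ₁}^∞ = K_{Θ₁} ∩ H^∞(E)`. -/
def HasSymbol (Θ₁ Θ₂ : LpT ∞ (E →L[ℂ] E)) (A : modelSpace Θ₁ →L[ℂ] modelSpace Θ₂)
    (Φ : LpT 2 (E →L[ℂ] E)) : Prop :=
  ∀ (f : modelSpace Θ₁) (hf : MemLp (f : LpT 2 E) ∞ leb),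
    A f = (modelSpace Θ₂).orthogonalProjectionOnto (symbolMul Φ (hf.toLp _))

/-- `T(Θ₁, Θ₂)`: the (bounded) matrix valued asymmetric truncated Toeplitz operators. -/
def asymTTO (Θ₁ Θ₂ : LpT ∞ (E →L[ℂ] E)) : Set (modelSpace Θ₁ →L[ℂ] modelSpace Θ₂) :=
  {A | ∃ Φ : LpT 2 (E →L[ℂ] E), HasSymbol Θ₁ Θ₂ A Φ}

/-- The pointwise product `Θ F ∈ L²(L(E))` of `Θ ∈ L^∞(L(E))` and `F ∈ L²(L(E))`. -/
def opMul (Θ : LpT ∞ (E →L[ℂ] E)) (F : LpT 2 (E →L[ℂ] E)) : LpT 2 (E →L[ℂ] E) :=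
  (ContinuousLinearMap.mul ℂ (E →L[ℂ] E)).holder 2 Θ F

/-- The inner product of `L²(L(E))` for the Hilbert-Schmidt norm on `L(E)`:
`(1/2π) ∫ tr (Ψ(e^{it})* Φ(e^{it})) dt`. -/
def hsInner (Φ Ψ : LpT 2 (E →L[ℂ] E)) : ℂ :=
  ∫ t, LinearMap.trace ℂ E (star (Ψ t) * Φ t : E →L[ℂ] E).toLinearMap ∂leb

/-- `M_Θ`, the orthogonal complement of `Θ H²(L(E))` in `H²(L(E))`, where `L(E)` carries the
Hilbert-Schmidt norm. -/
def symbolSpace (Θ : LpT ∞ (E →L[ℂ] E)) : Set (LpT 2 (E →L[ℂ] E)) :=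
  {Ψ | Ψ ∈ hardy (E →L[ℂ] E) ∧ ∀ F ∈ hardy (E →L[ℂ] E), hsInner Ψ (opMul Θ F) = 0}

/-- `k_0^Θ(z) = I - Θ(z) Θ(0)*`. -/
def kernelZero (Θ : LpT ∞ (E →L[ℂ] E)) : LpT ∞ (E →L[ℂ] E) :=
  Lp.const ∞ leb 1 -
    (ContinuousLinearMap.mul ℂ (E →L[ℂ] E)).holder ∞ Θ (Lp.const ∞ leb (star (valueZero Θ)))

/-- `k_0^Θ X`, the function `z ↦ k_0^Θ(z) X`, for `X ∈ L(E)`. -/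
def kernelZeroMul (Θ : LpT ∞ (E →L[ℂ] E)) (X : E →L[ℂ] E) : LpT 2 (E →L[ℂ] E) :=
  opMul (kernelZero Θ) (Lp.const 2 leb X)

end

end AsymTTO

/-!
Write `U = Θ₁`, `V = Θ₂`. Fourier coefficients of a bilinear product are given by convolution
(`fourierCoeff_bilin_eq_zero`), and this turns all the spaces involved into conditions on
coefficients of functions: `f ∈ K_Θ` means that `f` is analytic and `Θ* f` coanalytic (`InModel`),
`Ψ ∈ M_Θ` means the same for the operator-valued `Ψ` (`InModelOp`), and `g ∈ K_Θ^⊥` means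
`g ∈ Θ H² + (H²)^⊥` (`PerpModel`). Then `A_Φ = 0` says that `Φ f ∈ K_V^⊥` for every bounded
`f ∈ K_U` (`KillsModel`).

Symbols in `V H² + (U H²)*` give the zero operator (`killsModel_of_mem`). Since
`H²(L(E)) = M_Θ ⊕ Θ H²(L(E))`, every symbol can be moved into `M_V + M_U*` modulo such symbols,
which is the existence of `Ψ₁` and `Ψ₂` (`exists_inModelOp_symbol`). Also
`k₀^V X - (k₀^U X*)* = -V V(0)* X + (U U(0)* X*)*` is such a symbol, so all the pairs
`(k₀^V X, -k₀^U X*)` represent zero.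

Conversely, let `Ψ ∈ M_V`, `χ ∈ M_U` and `A_{Ψ + χ*} = 0`. The space `K_U` is invariant under the
backward shift `f ↦ z̄ (f - f(0))`. Comparing `Φ f` with `z Φ (z̄ (f - f(0)))` for `Φ = Ψ + χ*` gives
`Φ f(0) ∈ V H² + E + (H²)^⊥` (`KillsModel.exists_apply_value`). As `U` is pure, `1 - U(0) U(0)*` is
invertible and `f = k₀^U y` takes every value at the origin; so each column `Ψ x` agrees with some
`k₀^V w` modulo `K_V^⊥`, hence equals it, and `Ψ = k₀^V X`. After subtracting the trivial pair of
`X` the symbol is `χ'*` with `χ' ∈ M_U`, and `χ' = 0` follows (`InModelOp.ae_eq_zero`) because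
`V H²` contains no nonzero constants when `V` is pure (`IsInnerFun.apply_ae_eq_zero`).
-/

namespace AsymTTO

set_option linter.unusedSectionVars false

/-! ### Fourier coefficients of vector-valued functions -/

section Fourier

variable {W W₁ W₂ : Type*} [NormedAddCommGroup W] [NormedSpace ℂ W]
  [NormedAddCommGroup W₁] [NormedSpace ℂ W₁] [NormedAddCommGroup W₂] [NormedSpace ℂ W₂]

lemma memLp_top_fourier (n : ℤ) : MemLp (fun t : Torus => fourier n t) ∞ leb :=
  memLp_top_of_bound (map_continuous (fourier n)).aestronglyMeasurable 1
    (ae_of_all _ fun t => by rw [fourier_apply, Circle.norm_coe])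

lemma _root_.MeasureTheory.MemLp.fourier_smul {p : ℝ≥0∞} {f : Torus → W} (hf : MemLp f p leb)
    (m : ℤ) : MemLp (fun t => fourier m t • f t) p leb :=
  (ContinuousLinearMap.lsmul ℂ ℂ (E := W)).memLp_of_bilin p (memLp_top_fourier m) hf

lemma _root_.MeasureTheory.MemLp.integrable_two {V : Type*} [NormedAddCommGroup V]
    {f : Torus → V} (hf : MemLp f 2 leb) :
    Integrable f leb := hf.integrable one_le_two

lemma fourierCoeff_add' {f g : Torus → W} (hf : Integrable f leb) (hg : Integrable g leb)
    (n : ℤ) : fourierCoeff (fun t => f t + g t) n = fourierCoeff f n + fourierCoeff g n :=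
  congrFun (fourierCoeff.add hf hg) n

lemma fourierCoeff_neg' (f : Torus → W) (n : ℤ) :
    fourierCoeff (fun t => -f t) n = -fourierCoeff f n := by
  simp only [fourierCoeff, smul_neg, integral_neg]

lemma fourierCoeff_sub' {f g : Torus → W} (hf : Integrable f leb) (hg : Integrable g leb)
    (n : ℤ) : fourierCoeff (fun t => f t - g t) n = fourierCoeff f n - fourierCoeff g n := by
  have h := fourierCoeff_add' hf hg.neg n
  rw [show -g = fun t => -g t from rfl, fourierCoeff_neg'] at h
  simpa only [sub_eq_add_neg] using h

lemma fourierCoeff_fourier_smul (f : Torus → W) (m n : ℤ) :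
    fourierCoeff (fun t => fourier m t • f t) n = fourierCoeff f (n - m) := by
  simp only [fourierCoeff, smul_smul, ← fourier_add]
  congr! 4
  ring_nf

lemma fourierCoeff_clm [CompleteSpace W₁] [CompleteSpace W₂] (L : W₁ →L[ℂ] W₂) {f : Torus → W₁}
    (hf : Integrable f leb) (n : ℤ) :
    fourierCoeff (fun t => L (f t)) n = L (fourierCoeff f n) := by
  rw [fourierCoeff, fourierCoeff, ← L.integral_comp_comm (hf.fourier_smul _)]
  simp only [map_smul]

/-- Conjugate-linear maps reverse the index of Fourier coefficients. -/
lemma fourierCoeff_conjLinear [CompleteSpace W₁] [CompleteSpace W₂] (L : W₁ →L⋆[ℂ] W₂)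
    {f : Torus → W₁} (hf : Integrable f leb) (n : ℤ) :
    fourierCoeff (fun t => L (f t)) n = L (fourierCoeff f (-n)) := by
  rw [fourierCoeff, fourierCoeff, ← L.integral_comp_commSL (by simp) (hf.fourier_smul _)]
  simp only [map_smulₛₗ, neg_neg, fourier_neg]

lemma fourierCoeff_const [CompleteSpace W] (w : W) (n : ℤ) :
    fourierCoeff (fun _ : Torus => w) n = if n = 0 then w else 0 := by
  have h := fourierCoeff_clm (ContinuousLinearMap.toSpanSingleton ℂ w)
    ((memLp_top_fourier 0).integrable le_top) n
  simp only [fourier_zero, ContinuousLinearMap.toSpanSingleton_apply, one_smul] at h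
  rw [h, show (fun _ : Torus => (1 : ℂ)) = fourier 0 by ext; simp, fourierCoeff_fourier]
  by_cases hn : n = 0
  · subst hn; simp
  · rw [if_neg hn, Pi.single_eq_of_ne hn, zero_smul]

/-- Parseval for the product of two scalar functions: the Fourier coefficients of the product are
obtained by convolution, so one of them vanishes when all terms of the convolution do. -/
lemma fourierCoeff_mul_eq_zero {f g : Torus → ℂ} (hf : MemLp f 2 leb) (hg : MemLp g 2 leb) {n : ℤ}
    (h : ∀ k, fourierCoeff f (n - k) = 0 ∨ fourierCoeff g k = 0) :
    fourierCoeff (fun t => f t * g t) n = 0 := by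
  have hF : MemLp (fun t => fourier n t • star (f t)) 2 leb := hf.star.fourier_smul n
  have hFk (k : ℤ) : fourierCoeff (fun t => fourier n t • star (f t)) k =
      star (fourierCoeff f (n - k)) := by
    rw [fourierCoeff_fourier_smul]
    have := fourierCoeff_conjLinear (starL ℂ (A := ℂ)).toContinuousLinearMap
      hf.integrable_two (k - n)
    simpa using this
  have key := fourierBasis.tsum_inner_mul_inner (hF.toLp _) (hg.toLp _)
  have h0 : fourierCoeff (fun t => f t * g t) n = ⟪hF.toLp _, hg.toLp _⟫_ℂ := by
    rw [L2.inner_def]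
    refine integral_congr_ae ?_
    filter_upwards [hF.coeFn_toLp, hg.coeFn_toLp] with t h1 h2
    rw [h1, h2]
    simp
    ring
  rw [h0, ← key]
  refine (tsum_congr fun k => ?_).trans tsum_zero
  rw [← inner_conj_symm, ← HilbertBasis.repr_apply_apply, ← HilbertBasis.repr_apply_apply,
    fourierBasis_repr, fourierBasis_repr, fourierCoeff_congr_ae hF.coeFn_toLp,
    fourierCoeff_congr_ae hg.coeFn_toLp, hFk]
  rcases h k with h | h <;> simp [h]

/-- The coordinates of a finite-dimensional space as continuous functionals. -/
noncomputable def coordL (W : Type*) [NormedAddCommGroup W] [NormedSpace ℂ W]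
    [FiniteDimensional ℂ W] (i : Fin (Module.finrank ℂ W)) : W →L[ℂ] ℂ :=
  LinearMap.toContinuousLinearMap ((Module.finBasis ℂ W).coord i)

lemma sum_coordL_smul [FiniteDimensional ℂ W] (w : W) :
    ∑ i, coordL W i w • Module.finBasis ℂ W i = w :=
  (Module.finBasis ℂ W).sum_repr w

lemma fourierCoeff_finsum {ι : Type*} [Fintype ι] (f : ι → Torus → W)
    (hf : ∀ i, Integrable (f i) leb) (n : ℤ) :
    fourierCoeff (fun t => ∑ i, f i t) n = ∑ i, fourierCoeff (f i) n := by
  have := congrFun (fourierCoeff.sum Finset.univ f fun i _ => hf i) n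
  simpa only [Finset.sum_apply, Finset.sum_fn] using this

/-- The convolution principle for a bilinear product of vector-valued functions: if every term
`B (f̂ (n - k)) (ĝ k)` vanishes because one of the factors does, so does the coefficient of index
`n` of `B(f, g)`. -/
lemma fourierCoeff_bilin_eq_zero [FiniteDimensional ℂ W₁] [FiniteDimensional ℂ W₂]
    [CompleteSpace W₁] [CompleteSpace W₂] [CompleteSpace W]
    (B : W₁ →L[ℂ] W₂ →L[ℂ] W) {f : Torus → W₁} {g : Torus → W₂}
    (hf : MemLp f 2 leb) (hg : MemLp g 2 leb) {n : ℤ}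
    (h : ∀ k, fourierCoeff f (n - k) = 0 ∨ fourierCoeff g k = 0) :
    fourierCoeff (fun t => B (f t) (g t)) n = 0 := by
  have hfi i : MemLp (fun t => coordL W₁ i (f t)) 2 leb := (coordL W₁ i).comp_memLp' hf
  have hgj j : MemLp (fun t => coordL W₂ j (g t)) 2 leb := (coordL W₂ j).comp_memLp' hg
  have hij i j : Integrable (fun t => coordL W₁ i (f t) * coordL W₂ j (g t)) leb :=
    (hfi i).integrable_mul (hgj j)
  have e : (fun t => B (f t) (g t)) = fun t => ∑ p : _ × _,
      ContinuousLinearMap.toSpanSingleton ℂ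
        (B (Module.finBasis ℂ W₁ p.1) (Module.finBasis ℂ W₂ p.2))
        (coordL W₁ p.1 (f t) * coordL W₂ p.2 (g t)) := by
    funext t
    conv_lhs => rw [← sum_coordL_smul (f t), ← sum_coordL_smul (g t)]
    simp only [map_sum, map_smul, _root_.sum_apply, _root_.smul_apply,
      Fintype.sum_prod_type, ContinuousLinearMap.toSpanSingleton_apply, mul_smul, Finset.smul_sum]
    rw [Finset.sum_comm]
    simp only [smul_comm (coordL W₁ _ _)]
  rw [e, fourierCoeff_finsum _ fun p => ContinuousLinearMap.integrable_comp _ (hij _ _)]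
  refine Finset.sum_eq_zero fun p _ => ?_
  rw [fourierCoeff_clm _ (hij _ _), fourierCoeff_mul_eq_zero (hfi _) (hgj _), map_zero]
  intro k
  rw [fourierCoeff_clm _ hf.integrable_two, fourierCoeff_clm _ hg.integrable_two]
  exact (h k).imp (fun h => by rw [h, map_zero]) fun h => by rw [h, map_zero]

/-- A square integrable function is determined by its Fourier coefficients. -/
lemma ae_eq_zero_of_fourierCoeff [FiniteDimensional ℂ W] [CompleteSpace W] {f : Torus → W}
    (hf : MemLp f 2 leb) (h : ∀ n, fourierCoeff f n = 0) : ∀ᵐ t ∂leb, f t = 0 := by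
  have hi i : ∀ᵐ t ∂leb, coordL W i (f t) = 0 := by
    have hfi : MemLp (fun t => coordL W i (f t)) 2 leb := (coordL W i).comp_memLp' hf
    have h0 : hfi.toLp _ = 0 := by
      apply fourierBasis.repr.injective
      ext n
      rw [fourierBasis_repr, fourierCoeff_congr_ae hfi.coeFn_toLp,
        fourierCoeff_clm _ hf.integrable_two, h]
      simp
    filter_upwards [hfi.coeFn_toLp, Lp.coeFn_zero ℂ 2 leb] with t h1 h2
    rw [← h1, h0, h2]
    rfl
  filter_upwards [ae_all_iff.2 hi] with t ht
  rw [← sum_coordL_smul (f t)]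
  simp [ht]

/-- The Riesz projection: cutting off the Fourier coefficients of negative index. -/
lemma exists_analytic_part [FiniteDimensional ℂ W] [CompleteSpace W] {f : Torus → W}
    (hf : MemLp f 2 leb) : ∃ p : Torus → W, MemLp p 2 leb ∧
      ∀ n, fourierCoeff p n = if 0 ≤ n then fourierCoeff f n else 0 := by
  have scalar (g : LpT 2 ℂ) : ∃ p : LpT 2 ℂ,
      ∀ n, fourierCoeff p n = if 0 ≤ n then fourierCoeff g n else 0 := by
    have : CompleteSpace (hardy ℂ) := (isClosed_hardy ℂ).completeSpace_coe
    have hp := (hardy ℂ).sub_starProjection_mem_orthogonal g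
    refine ⟨(hardy ℂ).starProjection g, fun n => ?_⟩
    split_ifs with hn
    · have hmem : (fourierLp 2 n : LpT 2 ℂ) ∈ hardy ℂ := by
        rw [mem_hardy]
        intro m hm
        rw [fourierCoeff_congr_ae (coeFn_fourierLp 2 n), fourierCoeff_fourier,
          Pi.single_eq_of_ne (by omega)]
      have h0 := hp _ hmem
      rw [← coe_fourierBasis, ← HilbertBasis.repr_apply_apply, map_sub, lp.coeFn_sub,
        Pi.sub_apply, fourierBasis_repr, fourierBasis_repr, sub_eq_zero] at h0
      exact h0.symm
    · exact mem_hardy.1 ((hardy ℂ).starProjection_apply_mem g) n (not_le.1 hn)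
  have hfi i : MemLp (fun t => coordL W i (f t)) 2 leb := (coordL W i).comp_memLp' hf
  choose p hp using fun i => scalar ((hfi i).toLp _)
  have hpi i : MemLp (fun t => ContinuousLinearMap.toSpanSingleton ℂ (Module.finBasis ℂ W i)
      (p i t)) 2 leb := ContinuousLinearMap.comp_memLp' _ (Lp.memLp (p i))
  refine ⟨fun t => ∑ i, ContinuousLinearMap.toSpanSingleton ℂ (Module.finBasis ℂ W i) (p i t),
    memLp_finsetSum _ fun i _ => hpi i, fun n => ?_⟩
  rw [fourierCoeff_finsum _ fun i => (hpi i).integrable_two]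
  simp only [fourierCoeff_clm _ (Lp.memLp (p _)).integrable_two, hp,
    fourierCoeff_congr_ae (hfi _).coeFn_toLp, fourierCoeff_clm _ hf.integrable_two]
  split_ifs
  · exact sum_coordL_smul _
  · simp

end Fourier

/-! ### Analytic and coanalytic functions -/

section Analytic

variable {W W₁ W₂ : Type*} [NormedAddCommGroup W] [NormedSpace ℂ W]
  [NormedAddCommGroup W₁] [NormedSpace ℂ W₁] [NormedAddCommGroup W₂] [NormedSpace ℂ W₂]

/-- A function representing an element of `H²(W)`. -/
structure IsAnalytic (f : Torus → W) : Prop where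
  memLp : MemLp f 2 leb
  coeff : ∀ n < 0, fourierCoeff f n = 0

/-- A square integrable function with vanishing Fourier coefficients of index `≥ 0`. For functions
with values in a Hilbert space these represent the orthogonal complement of `H²`. -/
structure IsCoanalytic (f : Torus → W) : Prop where
  memLp : MemLp f 2 leb
  coeff : ∀ n, 0 ≤ n → fourierCoeff f n = 0

lemma IsAnalytic.congr {f g : Torus → W} (hf : IsAnalytic f) (h : f =ᵐ[leb] g) : IsAnalytic g :=
  ⟨hf.memLp.ae_eq h, fourierCoeff_congr_ae h ▸ hf.coeff⟩

lemma IsCoanalytic.congr {f g : Torus → W} (hf : IsCoanalytic f) (h : f =ᵐ[leb] g) :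
    IsCoanalytic g :=
  ⟨hf.memLp.ae_eq h, fourierCoeff_congr_ae h ▸ hf.coeff⟩

lemma IsAnalytic.add {f g : Torus → W} (hf : IsAnalytic f) (hg : IsAnalytic g) :
    IsAnalytic fun t => f t + g t :=
  ⟨hf.memLp.add hg.memLp, fun n hn => by
    rw [fourierCoeff_add' hf.memLp.integrable_two hg.memLp.integrable_two, hf.coeff n hn,
      hg.coeff n hn, add_zero]⟩

lemma IsAnalytic.sub {f g : Torus → W} (hf : IsAnalytic f) (hg : IsAnalytic g) :
    IsAnalytic fun t => f t - g t :=
  ⟨hf.memLp.sub hg.memLp, fun n hn => by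
    rw [fourierCoeff_sub' hf.memLp.integrable_two hg.memLp.integrable_two, hf.coeff n hn,
      hg.coeff n hn, sub_zero]⟩

lemma IsCoanalytic.add {f g : Torus → W} (hf : IsCoanalytic f) (hg : IsCoanalytic g) :
    IsCoanalytic fun t => f t + g t :=
  ⟨hf.memLp.add hg.memLp, fun n hn => by
    rw [fourierCoeff_add' hf.memLp.integrable_two hg.memLp.integrable_two, hf.coeff n hn,
      hg.coeff n hn, add_zero]⟩

lemma IsCoanalytic.sub {f g : Torus → W} (hf : IsCoanalytic f) (hg : IsCoanalytic g) :
    IsCoanalytic fun t => f t - g t :=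
  ⟨hf.memLp.sub hg.memLp, fun n hn => by
    rw [fourierCoeff_sub' hf.memLp.integrable_two hg.memLp.integrable_two, hf.coeff n hn,
      hg.coeff n hn, sub_zero]⟩

lemma IsAnalytic.clm [CompleteSpace W₁] [CompleteSpace W₂] {f : Torus → W₁} (hf : IsAnalytic f)
    (L : W₁ →L[ℂ] W₂) : IsAnalytic fun t => L (f t) :=
  ⟨L.comp_memLp' hf.memLp, fun n hn => by
    rw [fourierCoeff_clm L hf.memLp.integrable_two, hf.coeff n hn, map_zero]⟩

lemma IsCoanalytic.clm [CompleteSpace W₁] [CompleteSpace W₂] {f : Torus → W₁}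
    (hf : IsCoanalytic f) (L : W₁ →L[ℂ] W₂) : IsCoanalytic fun t => L (f t) :=
  ⟨L.comp_memLp' hf.memLp, fun n hn => by
    rw [fourierCoeff_clm L hf.memLp.integrable_two, hf.coeff n hn, map_zero]⟩

lemma isAnalytic_const [CompleteSpace W] (w : W) : IsAnalytic fun _ : Torus => w :=
  ⟨memLp_const w, fun n hn => by rw [fourierCoeff_const, if_neg (by omega)]⟩

/-- Multiplication by `z` preserves `H²`. -/
lemma IsAnalytic.shift {f : Torus → W} (hf : IsAnalytic f) :
    IsAnalytic fun t => fourier 1 t • f t :=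
  ⟨hf.memLp.fourier_smul 1, fun n hn => by
    rw [fourierCoeff_fourier_smul, hf.coeff _ (by omega)]⟩

lemma isAnalytic_fourier_smul_const [CompleteSpace W] {n : ℤ} (hn : 0 ≤ n) (w : W) :
    IsAnalytic fun t : Torus => fourier n t • w :=
  ⟨(memLp_const w).fourier_smul n, fun m hm => by
    rw [fourierCoeff_fourier_smul n m (f := fun _ => w), fourierCoeff_const, if_neg (by omega)]⟩

/-- `f = f₊ + f₋` with `f₊` analytic and `f₋` coanalytic. -/
lemma exists_analytic_add_coanalytic [FiniteDimensional ℂ W] [CompleteSpace W] {f : Torus → W}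
    (hf : MemLp f 2 leb) : ∃ p, IsAnalytic p ∧ IsCoanalytic fun t => f t - p t := by
  obtain ⟨p, hp, hpc⟩ := exists_analytic_part hf
  refine ⟨p, ⟨hp, fun n hn => by rw [hpc, if_neg (by omega)]⟩, hf.sub hp, fun n hn => ?_⟩
  rw [fourierCoeff_sub' hf.integrable_two hp.integrable_two, hpc, if_pos hn, sub_self]

end Analytic

/-! ### Model spaces in terms of functions -/

section Operators

variable {E : Type*} [NormedAddCommGroup E] [InnerProductSpace ℂ E] [FiniteDimensional ℂ E]
  [CompleteSpace E]

lemma memLp_apply {p q r : ℝ≥0∞} [ENNReal.HolderTriple p q r] {F : Torus → E →L[ℂ] E}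
    {f : Torus → E} (hF : MemLp F p leb) (hf : MemLp f q leb) :
    MemLp (fun t => F t (f t)) r leb :=
  (ContinuousLinearMap.id ℂ (E →L[ℂ] E)).memLp_of_bilin r hF hf

lemma memLp_mul {p q r : ℝ≥0∞} [ENNReal.HolderTriple p q r] {F G : Torus → E →L[ℂ] E}
    (hF : MemLp F p leb) (hG : MemLp G q leb) : MemLp (fun t => F t * G t) r leb :=
  (ContinuousLinearMap.mul ℂ (E →L[ℂ] E)).memLp_of_bilin r hF hG

lemma memLp_star {p : ℝ≥0∞} {F : Torus → E →L[ℂ] E} (hF : MemLp F p leb) :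
    MemLp (fun t => star (F t)) p leb := hF.star

lemma memLp_column {p : ℝ≥0∞} {F : Torus → E →L[ℂ] E} (hF : MemLp F p leb) (x : E) :
    MemLp (fun t => F t x) p leb :=
  (ContinuousLinearMap.apply ℂ E x).comp_memLp' hF

lemma fourierCoeff_column {F : Torus → E →L[ℂ] E} (hF : Integrable F leb) (x : E) (n : ℤ) :
    fourierCoeff (fun t => F t x) n = fourierCoeff F n x :=
  fourierCoeff_clm (ContinuousLinearMap.apply ℂ E x) hF n

lemma fourierCoeff_star {F : Torus → E →L[ℂ] E} (hF : Integrable F leb) (n : ℤ) :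
    fourierCoeff (fun t => star (F t)) n = star (fourierCoeff F (-n)) :=
  fourierCoeff_conjLinear (starL ℂ (A := E →L[ℂ] E)).toContinuousLinearMap hF n

lemma fourierCoeff_apply_eq_zero {F : Torus → E →L[ℂ] E} {f : Torus → E} (hF : MemLp F 2 leb)
    (hf : MemLp f 2 leb) {n : ℤ} (h : ∀ k, fourierCoeff F (n - k) = 0 ∨ fourierCoeff f k = 0) :
    fourierCoeff (fun t => F t (f t)) n = 0 :=
  fourierCoeff_bilin_eq_zero (ContinuousLinearMap.id ℂ (E →L[ℂ] E)) hF hf h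

lemma IsAnalytic.apply {F : Torus → E →L[ℂ] E} {f : Torus → E} (hF : IsAnalytic F)
    (hf : IsAnalytic f) (h : MemLp (fun t => F t (f t)) 2 leb) :
    IsAnalytic fun t => F t (f t) :=
  ⟨h, fun n hn => fourierCoeff_apply_eq_zero hF.memLp hf.memLp fun k => by
    by_cases hk : k < 0
    · exact .inr (hf.coeff k hk)
    · exact .inl (hF.coeff _ (by omega))⟩

/-- The adjoint of an analytic function multiplies coanalytic functions into coanalytic ones. -/
lemma IsCoanalytic.star_apply {F : Torus → E →L[ℂ] E} {f : Torus → E} (hF : IsAnalytic F)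
    (hf : IsCoanalytic f) (h : MemLp (fun t => star (F t) (f t)) 2 leb) :
    IsCoanalytic fun t => star (F t) (f t) :=
  ⟨h, fun n hn => fourierCoeff_apply_eq_zero (memLp_star hF.memLp) hf.memLp fun k => by
    by_cases hk : 0 ≤ k
    · exact .inr (hf.coeff k hk)
    · left
      rw [fourierCoeff_star hF.memLp.integrable_two, hF.coeff _ (by omega), star_zero]⟩

/-- Parseval: functions whose Fourier coefficients have disjoint supports are orthogonal. -/
lemma integral_inner_eq_zero {f g : Torus → E} (hf : MemLp f 2 leb) (hg : MemLp g 2 leb)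
    (h : ∀ k, fourierCoeff f k = 0 ∨ fourierCoeff g k = 0) : ∫ t, ⟪f t, g t⟫_ℂ ∂leb = 0 := by
  have hf' : MemLp (fun t => innerSL ℂ (f t)) 2 leb :=
    hf.of_le ((innerSL ℂ (E := E)).continuous.comp_aestronglyMeasurable hf.1)
      (ae_of_all _ fun t => (innerSL_apply_norm ℂ (f t)).le)
  have := fourierCoeff_bilin_eq_zero (ContinuousLinearMap.id ℂ (E →L[ℂ] ℂ)) hf' hg (n := 0)
    fun k => by
      rw [fourierCoeff_conjLinear _ hf.integrable_two]
      exact (h k).imp (fun h => by simp [h]) id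
  simpa [fourierCoeff] using this

lemma IsAnalytic.integral_inner {f g : Torus → E} (hf : IsAnalytic f) (hg : IsCoanalytic g) :
    ∫ t, ⟪f t, g t⟫_ℂ ∂leb = 0 :=
  integral_inner_eq_zero hf.memLp hg.memLp fun k => by
    by_cases hk : k < 0
    · exact .inl (hf.coeff k hk)
    · exact .inr (hg.coeff k (by omega))

lemma integral_inner_fourier_smul {g : Torus → E} (hg : MemLp g 2 leb) (n : ℤ) (x : E) :
    ∫ t, ⟪fourier n t • x, g t⟫_ℂ ∂leb = ⟪x, fourierCoeff g n⟫_ℂ := by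
  have := fourierCoeff_clm (innerSL ℂ x) hg.integrable_two n
  simp only [innerSL_apply_apply] at this
  rw [← this, fourierCoeff]
  simp only [inner_smul_left, fourier_neg, smul_eq_mul]

lemma mem_hardy_iff {f : LpT 2 E} : f ∈ hardy E ↔ IsAnalytic f :=
  mem_hardy.trans ⟨fun h => ⟨Lp.memLp f, h⟩, fun h => h.coeff⟩

/-- A bounded analytic operator-valued function which is isometric a.e. on the circle. -/
structure IsInnerFun (Θ : Torus → E →L[ℂ] E) : Prop where
  memLp_top : MemLp Θ ∞ leb
  analytic : IsAnalytic Θ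
  star_mul : ∀ᵐ t ∂leb, star (Θ t) * Θ t = 1

lemma IsInner.isInnerFun {Θ : LpT ∞ (E →L[ℂ] E)} (h : IsInner Θ) : IsInnerFun Θ where
  memLp_top := Lp.memLp Θ
  analytic := ⟨(Lp.memLp Θ).mono_exponent le_top, h.analytic⟩
  star_mul := by
    filter_upwards [h.isometry] with t ht
    exact (Θ t).norm_map_iff_adjoint_comp_self.1 ((AddMonoidHomClass.isometry_iff_norm _).1 ht)

variable {Θ : Torus → E →L[ℂ] E}

lemma IsInnerFun.star_apply (hΘ : IsInnerFun Θ) (f : Torus → E) :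
    (fun t => star (Θ t) (Θ t (f t))) =ᵐ[leb] f := by
  filter_upwards [hΘ.star_mul] with t ht
  exact congrArg (fun S : E →L[ℂ] E => S (f t)) ht

lemma IsInnerFun.mul_star (hΘ : IsInnerFun Θ) : ∀ᵐ t ∂leb, Θ t * star (Θ t) = 1 := by
  filter_upwards [hΘ.star_mul] with t ht
  have h : (star (Θ t)).toLinearMap * (Θ t).toLinearMap = 1 :=
    congrArg ContinuousLinearMap.toLinearMap ht
  rw [mul_eq_one_comm] at h
  exact ContinuousLinearMap.coe_injective h

/-- The functions representing elements of `K_Θ`: analytic `f` with `Θ* f` coanalytic. -/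
structure InModel (Θ : Torus → E →L[ℂ] E) (f : Torus → E) : Prop where
  analytic : IsAnalytic f
  coanalytic : IsCoanalytic fun t => star (Θ t) (f t)

/-- The functions representing elements of `K_Θ^⊥ = Θ H²(E) ⊕ H²(E)^⊥`. -/
def PerpModel (Θ : Torus → E →L[ℂ] E) (g : Torus → E) : Prop :=
  ∃ h, IsAnalytic h ∧ IsCoanalytic fun t => g t - Θ t (h t)

lemma InModel.congr {f g : Torus → E} (hf : InModel Θ f) (h : f =ᵐ[leb] g) : InModel Θ g :=
  ⟨hf.analytic.congr h, hf.coanalytic.congr (h.mono fun t ht => by simp only [ht])⟩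

lemma PerpModel.congr {f g : Torus → E} (hf : PerpModel Θ f) (h : f =ᵐ[leb] g) :
    PerpModel Θ g := by
  obtain ⟨k, hk, hf⟩ := hf
  exact ⟨k, hk, hf.congr (h.mono fun t ht => by simp only [ht])⟩

lemma IsInnerFun.isAnalytic_apply (hΘ : IsInnerFun Θ) {h : Torus → E} (hh : IsAnalytic h) :
    IsAnalytic fun t => Θ t (h t) :=
  hΘ.analytic.apply hh (memLp_apply hΘ.memLp_top hh.memLp)

lemma integrable_inner {f g : Torus → E} (hf : MemLp f 2 leb) (hg : MemLp g 2 leb) :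
    Integrable (fun t => ⟪f t, g t⟫_ℂ) leb := by
  refine (L2.integrable_inner (𝕜 := ℂ) (hf.toLp f) (hg.toLp g)).congr ?_
  filter_upwards [hf.coeFn_toLp, hg.coeFn_toLp] with t h1 h2
  rw [h1, h2]

/-- `⟪f, Θ h⟫ = ⟪Θ* f, h⟫ = 0` for `f ∈ K_Θ` and `h ∈ H²`. -/
lemma InModel.integral_inner_apply {f h : Torus → E} (hf : InModel Θ f) (hh : IsAnalytic h) :
    ∫ t, ⟪f t, Θ t (h t)⟫_ℂ ∂leb = 0 := by
  have := integral_inner_eq_zero hf.coanalytic.memLp hh.memLp fun k => by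
    by_cases hk : k < 0
    · exact .inr (hh.coeff k hk)
    · exact .inl (hf.coanalytic.coeff k (by omega))
  simpa only [ContinuousLinearMap.star_eq_adjoint, ContinuousLinearMap.adjoint_inner_left]
    using this

lemma InModel.integral_inner_perp {f g : Torus → E} (hΘ : IsInnerFun Θ) (hf : InModel Θ f)
    (hg : PerpModel Θ g) : ∫ t, ⟪f t, g t⟫_ℂ ∂leb = 0 := by
  obtain ⟨h, hh, hg⟩ := hg
  have hΘh := (hΘ.isAnalytic_apply hh).memLp
  rw [← add_zero (0 : ℂ)]
  nth_rw 1 [← hf.integral_inner_apply hh]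
  rw [← hf.analytic.integral_inner hg, ← integral_add (integrable_inner hf.analytic.memLp hΘh)
    (integrable_inner hf.analytic.memLp hg.memLp)]
  simp only [← inner_add_right, add_sub_cancel]

lemma ae_eq_zero_of_integral_inner {f : Torus → E} (hf : MemLp f 2 leb)
    (h : ∫ t, ⟪f t, f t⟫_ℂ ∂leb = 0) : f =ᵐ[leb] 0 := by
  have h0 : ⟪hf.toLp f, hf.toLp f⟫_ℂ = 0 := by
    rw [L2.inner_def, ← h]
    refine integral_congr_ae ?_
    filter_upwards [hf.coeFn_toLp] with t ht
    rw [ht]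
  rw [inner_self_eq_zero] at h0
  filter_upwards [hf.coeFn_toLp, Lp.coeFn_zero E 2 leb] with t h1 h2
  rw [← h1, h0, h2]

lemma InModel.ae_eq_zero {f : Torus → E} (hΘ : IsInnerFun Θ) (hf : InModel Θ f)
    (hg : PerpModel Θ f) : f =ᵐ[leb] 0 :=
  ae_eq_zero_of_integral_inner hf.analytic.memLp (hf.integral_inner_perp hΘ hg)

/-- The decomposition `H²(W) = K ⊕ Θ H²(W)` where `L(E)` acts on `W` through `B`; it is used for
`W = E` and for `W = L(E)`. The component in `Θ H²(W)` of an analytic `f` is `Θ P₊(Θ* f)`. -/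
lemma IsInnerFun.exists_decomposition {W : Type*} [NormedAddCommGroup W] [NormedSpace ℂ W]
    [FiniteDimensional ℂ W] [CompleteSpace W] (hΘ : IsInnerFun Θ)
    (B : (E →L[ℂ] E) →L[ℂ] W →L[ℂ] W)
    (hB : ∀ S : E →L[ℂ] E, star S * S = 1 → ∀ w, B (star S) (B S w) = w)
    {f : Torus → W} (hf : IsAnalytic f) :
    ∃ h, IsAnalytic h ∧ IsAnalytic (fun t => f t - B (Θ t) (h t)) ∧
      IsCoanalytic fun t => B (star (Θ t)) (f t - B (Θ t) (h t)) := by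
  obtain ⟨h, hh, hc⟩ := exists_analytic_add_coanalytic
    (B.memLp_of_bilin 2 (memLp_star hΘ.memLp_top) hf.memLp)
  have hBh : IsAnalytic fun t => B (Θ t) (h t) :=
    ⟨B.memLp_of_bilin 2 hΘ.memLp_top hh.memLp, fun n hn =>
      fourierCoeff_bilin_eq_zero B hΘ.analytic.memLp hh.memLp fun k => by
        by_cases hk : k < 0
        · exact .inr (hh.coeff k hk)
        · exact .inl (hΘ.analytic.coeff _ (by omega))⟩
  refine ⟨h, hh, hf.sub hBh, hc.congr ?_⟩
  filter_upwards [hΘ.star_mul] with t ht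
  rw [map_sub, hB _ ht]

/-- `Θ H² ⊕ (H²)^⊥` is the whole orthogonal complement of `K_Θ`; this uses the decomposition of the
analytic part of `g`, so closedness of `Θ H²` is not needed separately. -/
lemma perpModel_iff {g : Torus → E} (hΘ : IsInnerFun Θ) (hg : MemLp g 2 leb) :
    PerpModel Θ g ↔ ∀ f, InModel Θ f → ∫ t, ⟪f t, g t⟫_ℂ ∂leb = 0 := by
  refine ⟨fun h f hf => hf.integral_inner_perp hΘ h, fun H => ?_⟩
  obtain ⟨p, hp, hc⟩ := exists_analytic_add_coanalytic hg
  obtain ⟨h, hh, hk, hkc⟩ := hΘ.exists_decomposition (ContinuousLinearMap.id ℂ (E →L[ℂ] E))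
    (fun S hS w => congrArg (fun T : E →L[ℂ] E => T w) hS) hp
  have hkm : InModel Θ (fun t => p t - Θ t (h t)) := ⟨hk, hkc⟩
  have hΘh := (hΘ.isAnalytic_apply hh).memLp
  replace hk := hkm.analytic
  -- the component `k = p - Θ h` of `g` in `K_Θ` is orthogonal to `g`, hence to itself
  have hk0 : (fun t => p t - Θ t (h t)) =ᵐ[leb] 0 := by
    refine ae_eq_zero_of_integral_inner hk.memLp ?_
    have e (t : Torus) : ⟪p t - Θ t (h t), p t - Θ t (h t)⟫_ℂ =
        ⟪p t - Θ t (h t), g t⟫_ℂ - ⟪p t - Θ t (h t), g t - p t⟫_ℂ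
          - ⟪p t - Θ t (h t), Θ t (h t)⟫_ℂ := by
      rw [← inner_sub_right, ← inner_sub_right]; congr 1; abel
    have i1 := integrable_inner hk.memLp hg
    have i2 := integrable_inner hk.memLp hc.memLp
    simp only [e]
    refine (integral_sub (i1.sub i2) (integrable_inner hk.memLp hΘh)).trans ?_
    rw [hkm.integral_inner_apply hh, sub_zero]
    refine (integral_sub i1 i2).trans ?_
    rw [H _ hkm, hk.integral_inner hc, sub_zero]
  refine ⟨h, hh, hc.congr ?_⟩
  filter_upwards [hk0] with t ht
  rw [sub_eq_zero.1 ht]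

lemma PerpModel.sub {f g : Torus → E} (hf : PerpModel Θ f) (hg : PerpModel Θ g) :
    PerpModel Θ fun t => f t - g t := by
  obtain ⟨h, hh, hf⟩ := hf
  obtain ⟨k, hk, hg⟩ := hg
  refine ⟨_, hh.sub hk, (hf.sub hg).congr (ae_of_all _ fun t => ?_)⟩
  simp only [map_sub]
  abel

end Operators

/-! ### Model spaces and symbols in `L²` -/

section Transfer

variable {E : Type*} [NormedAddCommGroup E] [InnerProductSpace ℂ E] [FiniteDimensional ℂ E]
  [CompleteSpace E] {Θ Θ₁ Θ₂ : LpT ∞ (E →L[ℂ] E)}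

lemma coeFn_mulL (f : LpT 2 E) : mulL Θ f =ᵐ[leb] fun t => Θ t (f t) :=
  (ContinuousLinearMap.id ℂ (E →L[ℂ] E)).coeFn_holder Θ f

lemma mem_modelSpace_iff (hΘ : IsInnerFun Θ) {f : LpT 2 E} : f ∈ modelSpace Θ ↔ InModel Θ f := by
  rw [modelSpace, Submodule.mem_inf, mem_hardy_iff]
  have hin (h : LpT 2 E) : ⟪f, mulL Θ h⟫_ℂ = ∫ t, ⟪f t, Θ t (h t)⟫_ℂ ∂leb := by
    rw [L2.inner_def]
    refine integral_congr_ae ?_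
    filter_upwards [coeFn_mulL (Θ := Θ) h] with t ht
    rw [ht]
  constructor
  · rintro ⟨h1, h2⟩
    refine ⟨h1, memLp_apply (memLp_star hΘ.memLp_top) h1.memLp, fun n hn => ?_⟩
    rw [Submodule.mem_orthogonal] at h2
    refine ext_inner_left ℂ fun x => ?_
    have hz := isAnalytic_fourier_smul_const hn x
    have hmem : hz.memLp.toLp _ ∈ hardy E :=
      mem_hardy_iff.2 (hz.congr hz.memLp.coeFn_toLp.symm)
    have h3 := h2 _ (Submodule.mem_map_of_mem hmem)
    rw [← integral_inner_fourier_smul (memLp_apply (memLp_star hΘ.memLp_top) h1.memLp),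
      inner_zero_right, ← h3]
    rw [L2.inner_def]
    refine integral_congr_ae ?_
    filter_upwards [coeFn_mulL (Θ := Θ) (hz.memLp.toLp _), hz.memLp.coeFn_toLp] with t ht ht'
    rw [ContinuousLinearMap.coe_coe, ht, ht', ContinuousLinearMap.star_eq_adjoint,
      ContinuousLinearMap.adjoint_inner_right]
  · refine fun h => ⟨h.analytic, ?_⟩
    rw [Submodule.mem_orthogonal']
    rintro _ ⟨g, hg, rfl⟩
    exact (hin g).trans (h.integral_inner_apply (mem_hardy_iff.1 hg))

lemma orthogonalProjectionOnto_eq_zero_iff_perpModel (hΘ : IsInnerFun Θ) {g : LpT 2 E} :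
    (modelSpace Θ).orthogonalProjectionOnto g = 0 ↔ PerpModel Θ g := by
  rw [Submodule.orthogonalProjectionOnto_eq_zero_iff, perpModel_iff hΘ (Lp.memLp g),
    Submodule.mem_orthogonal]
  constructor
  · intro H f hf
    have hmem : hf.analytic.memLp.toLp _ ∈ modelSpace Θ :=
      (mem_modelSpace_iff hΘ).2 (hf.congr hf.analytic.memLp.coeFn_toLp.symm)
    rw [← H _ hmem, L2.inner_def]
    refine integral_congr_ae ?_
    filter_upwards [hf.analytic.memLp.coeFn_toLp] with t ht
    rw [ht]
  · intro H f hf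
    rw [L2.inner_def]
    exact H f ((mem_modelSpace_iff hΘ).1 hf)

lemma coeFn_symbolMul (Φ : LpT 2 (E →L[ℂ] E)) (f : LpT ∞ E) :
    symbolMul Φ f =ᵐ[leb] fun t => Φ t (f t) :=
  (ContinuousLinearMap.id ℂ (E →L[ℂ] E)).coeFn_holder Φ f

lemma symbolMul_sub (Φ Φ' : LpT 2 (E →L[ℂ] E)) (f : LpT ∞ E) :
    symbolMul (Φ - Φ') f = symbolMul Φ f - symbolMul Φ' f := by
  have h := (ContinuousLinearMap.id ℂ (E →L[ℂ] E)).holder_add_left (r := 2) (Φ - Φ') Φ' f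
  rw [sub_add_cancel] at h
  exact eq_sub_of_add_eq h.symm

lemma HasSymbol.iff_sub {A : modelSpace Θ₁ →L[ℂ] modelSpace Θ₂} {Φ Φ' : LpT 2 (E →L[ℂ] E)}
    (h : HasSymbol Θ₁ Θ₂ A Φ) : HasSymbol Θ₁ Θ₂ A Φ' ↔ HasSymbol Θ₁ Θ₂ 0 (Φ' - Φ) := by
  refine forall₂_congr fun f hf => ?_
  rw [symbolMul_sub, map_sub, h f hf, zero_apply, eq_comm, eq_comm (a := 0), sub_eq_zero]

/-- `A_Φ = 0` exactly when `Φ` maps the bounded functions of `K_{Θ₁}` into `K_{Θ₂}^⊥`. -/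
lemma hasSymbol_zero_iff (h₁ : IsInnerFun Θ₁) (h₂ : IsInnerFun Θ₂) {Φ : LpT 2 (E →L[ℂ] E)} :
    HasSymbol Θ₁ Θ₂ 0 Φ ↔ ∀ f : Torus → E, MemLp f ∞ leb → InModel Θ₁ f →
      PerpModel Θ₂ fun t => Φ t (f t) := by
  constructor
  · intro H f hf hfm
    have hae := hfm.analytic.memLp.coeFn_toLp
    have hmem : hfm.analytic.memLp.toLp _ ∈ modelSpace Θ₁ :=
      (mem_modelSpace_iff h₁).2 (hfm.congr hae.symm)
    have hb : MemLp (hfm.analytic.memLp.toLp f) ∞ leb := hf.ae_eq hae.symm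
    have h0 := (H ⟨_, hmem⟩ hb).symm
    rw [zero_apply, orthogonalProjectionOnto_eq_zero_iff_perpModel h₂] at h0
    refine h0.congr ?_
    filter_upwards [coeFn_symbolMul Φ (hb.toLp _), hb.coeFn_toLp, hae] with t e1 e2 e3
    rw [e1, e2, e3]
  · intro H f hf
    rw [zero_apply, eq_comm, orthogonalProjectionOnto_eq_zero_iff_perpModel h₂]
    refine (H f hf ((mem_modelSpace_iff h₁).1 f.2)).congr ?_
    filter_upwards [coeFn_symbolMul Φ (hf.toLp _), hf.coeFn_toLp] with t e1 e2
    rw [e1, e2]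

end Transfer

/-! ### The symbol space `M_Θ` and the trace pairing -/

section SymbolSpace

variable {E : Type*} [NormedAddCommGroup E] [InnerProductSpace ℂ E] [FiniteDimensional ℂ E]
  [CompleteSpace E] {Θ : Torus → E →L[ℂ] E}

/-- The functions representing elements of `M_Θ`: analytic `Ψ` with `Θ* Ψ` coanalytic. -/
structure InModelOp (Θ Ψ : Torus → E →L[ℂ] E) : Prop where
  analytic : IsAnalytic Ψ
  coanalytic : IsCoanalytic fun t => star (Θ t) * Ψ t

lemma InModelOp.congr {Ψ Ψ' : Torus → E →L[ℂ] E} (hΨ : InModelOp Θ Ψ) (h : Ψ =ᵐ[leb] Ψ') :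
    InModelOp Θ Ψ' :=
  ⟨hΨ.analytic.congr h, hΨ.coanalytic.congr (h.mono fun t ht => by simp only [ht])⟩

lemma InModelOp.add {Ψ Ψ' : Torus → E →L[ℂ] E} (hΨ : InModelOp Θ Ψ) (hΨ' : InModelOp Θ Ψ') :
    InModelOp Θ fun t => Ψ t + Ψ' t :=
  ⟨hΨ.analytic.add hΨ'.analytic, by
    simpa only [mul_add] using hΨ.coanalytic.add hΨ'.coanalytic⟩

lemma InModelOp.sub {Ψ Ψ' : Torus → E →L[ℂ] E} (hΨ : InModelOp Θ Ψ) (hΨ' : InModelOp Θ Ψ') :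
    InModelOp Θ fun t => Ψ t - Ψ' t :=
  ⟨hΨ.analytic.sub hΨ'.analytic, by
    simpa only [mul_sub] using hΨ.coanalytic.sub hΨ'.coanalytic⟩

lemma InModelOp.column {Ψ : Torus → E →L[ℂ] E} (hΨ : InModelOp Θ Ψ) (x : E) :
    InModel Θ fun t => Ψ t x :=
  ⟨hΨ.analytic.clm (ContinuousLinearMap.apply ℂ E x),
    hΨ.coanalytic.clm (ContinuousLinearMap.apply ℂ E x)⟩

/-- The trace as a continuous functional on `L(E)`. -/
noncomputable def traceL (E : Type*) [NormedAddCommGroup E] [InnerProductSpace ℂ E]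
    [FiniteDimensional ℂ E] : (E →L[ℂ] E) →L[ℂ] ℂ :=
  LinearMap.toContinuousLinearMap (LinearMap.trace ℂ E ∘ₗ ContinuousLinearMap.coeLM ℂ)

lemma traceL_apply (S : E →L[ℂ] E) : traceL E S = LinearMap.trace ℂ E S.toLinearMap := rfl

lemma eq_zero_of_traceL_star_mul_self {S : E →L[ℂ] E} (h : traceL E (star S * S) = 0) : S = 0 := by
  rw [traceL_apply, LinearMap.trace_eq_sum_inner _ (stdOrthonormalBasis ℂ E)] at h
  have e i : ⟪stdOrthonormalBasis ℂ E i, (star S * S) (stdOrthonormalBasis ℂ E i)⟫_ℂ =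
      ((‖S (stdOrthonormalBasis ℂ E i)‖ ^ 2 : ℝ) : ℂ) := by
    rw [show (star S * S) (stdOrthonormalBasis ℂ E i) =
        ContinuousLinearMap.adjoint S (S (stdOrthonormalBasis ℂ E i)) from rfl,
      ContinuousLinearMap.adjoint_inner_right, inner_self_eq_norm_sq_to_K]
    simp
  simp only [ContinuousLinearMap.coe_coe, e] at h
  rw [← Complex.ofReal_sum, Complex.ofReal_eq_zero,
    Finset.sum_eq_zero_iff_of_nonneg fun i _ => sq_nonneg _] at h
  refine ContinuousLinearMap.coe_injective ((stdOrthonormalBasis ℂ E).toBasis.ext fun i => ?_)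
  have := h i (Finset.mem_univ i)
  simpa using this

/-- The trace pairing `(S, T) ↦ tr (S T)`. -/
noncomputable def tracePairing (E : Type*) [NormedAddCommGroup E] [InnerProductSpace ℂ E]
    [FiniteDimensional ℂ E] : (E →L[ℂ] E) →L[ℂ] (E →L[ℂ] E) →L[ℂ] ℂ :=
  (ContinuousLinearMap.compL ℂ (E →L[ℂ] E) (E →L[ℂ] E) ℂ (traceL E)).comp
    (ContinuousLinearMap.mul ℂ (E →L[ℂ] E))

lemma coeFn_opMul (Θ : LpT ∞ (E →L[ℂ] E)) (F : LpT 2 (E →L[ℂ] E)) :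
    opMul Θ F =ᵐ[leb] fun t => Θ t * F t :=
  (ContinuousLinearMap.mul ℂ (E →L[ℂ] E)).coeFn_holder Θ F

lemma mem_hardy_op_iff {f : LpT 2 (E →L[ℂ] E)} : f ∈ hardy (E →L[ℂ] E) ↔ IsAnalytic f :=
  mem_hardy.trans ⟨fun h => ⟨Lp.memLp f, h⟩, fun h => h.coeff⟩

lemma hsInner_opMul (Θ : LpT ∞ (E →L[ℂ] E)) (Ψ F : LpT 2 (E →L[ℂ] E)) :
    hsInner Ψ (opMul Θ F) = ∫ t, traceL E (star (F t) * (star (Θ t) * Ψ t)) ∂leb := by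
  refine integral_congr_ae ?_
  filter_upwards [coeFn_opMul Θ F] with t ht
  rw [ht, star_mul, mul_assoc, traceL_apply]

lemma mem_symbolSpace_iff {Θ : LpT ∞ (E →L[ℂ] E)} (hΘ : IsInnerFun Θ)
    {Ψ : LpT 2 (E →L[ℂ] E)} : Ψ ∈ symbolSpace Θ ↔ InModelOp Θ Ψ := by
  have hm : MemLp (fun t => star (Θ t) * Ψ t) 2 leb :=
    memLp_mul (memLp_star hΘ.memLp_top) (Lp.memLp Ψ)
  constructor
  · rintro ⟨h1, h2⟩
    refine ⟨mem_hardy_op_iff.1 h1, hm, fun n hn => eq_zero_of_traceL_star_mul_self ?_⟩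
    -- test against `F = z ^ n Y` with `Y` the coefficient that is to vanish
    set Y := fourierCoeff (fun t => star (Θ t) * Ψ t) n with hY
    have hz := isAnalytic_fourier_smul_const hn Y
    have h3 := h2 _ (mem_hardy_op_iff.2 (hz.congr hz.memLp.coeFn_toLp.symm))
    rw [hsInner_opMul] at h3
    rw [← h3]
    have h4 := fourierCoeff_clm (tracePairing E (star Y)) hm.integrable_two n
    rw [← hY] at h4
    refine h4.symm.trans (integral_congr_ae ?_)
    filter_upwards [hz.memLp.coeFn_toLp] with t ht
    rw [ht, star_smul, smul_mul_assoc, map_smul, fourier_neg]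
    rfl
  · refine fun h => ⟨mem_hardy_op_iff.2 h.analytic, fun F hF => ?_⟩
    replace hF := mem_hardy_op_iff.1 hF
    have := fourierCoeff_bilin_eq_zero (tracePairing E) (memLp_star hF.memLp) hm (n := 0)
      fun k => by
        by_cases hk : k < 0
        · left
          rw [fourierCoeff_star hF.memLp.integrable_two, hF.coeff _ (by omega), star_zero]
        · exact .inr (h.coanalytic.coeff k (by omega))
    rw [hsInner_opMul, ← this, fourierCoeff]
    simp only [neg_zero, fourier_zero, one_smul]
    rfl

end SymbolSpace

/-! ### The kernel `k₀^Θ` and the backward shift -/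

section Kernel

variable {E : Type*} [NormedAddCommGroup E] [InnerProductSpace ℂ E] [FiniteDimensional ℂ E]
  [CompleteSpace E]

/-- `k₀^Θ = 1 - Θ Θ(0)*`, as a function on the circle. -/
noncomputable def kernelFun (Θ : Torus → E →L[ℂ] E) (t : Torus) : E →L[ℂ] E :=
  1 - Θ t * star (fourierCoeff Θ 0)

variable {Θ : Torus → E →L[ℂ] E}

lemma coeFn_kernelZeroMul (Θ : LpT ∞ (E →L[ℂ] E)) (X : E →L[ℂ] E) :
    kernelZeroMul Θ X =ᵐ[leb] fun t => kernelFun Θ t * X := by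
  filter_upwards [coeFn_opMul (kernelZero Θ) (Lp.const 2 leb X), Lp.coeFn_const (p := 2) leb X,
    Lp.coeFn_sub (Lp.const ∞ leb (1 : E →L[ℂ] E)) ((ContinuousLinearMap.mul ℂ (E →L[ℂ] E)).holder ∞
      Θ (Lp.const ∞ leb (star (valueZero Θ)))), Lp.coeFn_const (p := ∞) leb (1 : E →L[ℂ] E),
    Lp.coeFn_const (p := ∞) leb (star (valueZero Θ)),
    (ContinuousLinearMap.mul ℂ (E →L[ℂ] E)).coeFn_holder (r := ∞) Θ
      (Lp.const ∞ leb (star (valueZero Θ)))] with t h1 h2 h3 h4 h5 h6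
  rw [kernelZeroMul, h1, h2, kernelZero, h3, Pi.sub_apply, h4, h6, h5]
  rfl

lemma memLp_top_kernelFun (hΘ : IsInnerFun Θ) : MemLp (kernelFun Θ) ∞ leb :=
  (memLp_const 1).sub (memLp_mul (q := ∞) hΘ.memLp_top (memLp_const (star (fourierCoeff Θ 0))))

lemma inModelOp_kernelFun_mul (hΘ : IsInnerFun Θ) (X : E →L[ℂ] E) :
    InModelOp Θ fun t => kernelFun Θ t * X := by
  have hR := hΘ.analytic.clm ((ContinuousLinearMap.mul ℂ (E →L[ℂ] E)).flip
    (star (fourierCoeff Θ 0) * X))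
  refine ⟨((isAnalytic_const X).sub hR).congr (ae_of_all _ fun t => ?_), ?_⟩
  · simp [kernelFun, sub_mul, mul_assoc]
  have hs := memLp_star hΘ.analytic.memLp
  have hsX : MemLp (fun t => star (Θ t) * X) 2 leb :=
    ((ContinuousLinearMap.mul ℂ (E →L[ℂ] E)).flip X).comp_memLp' hs
  -- `Θ* k₀^Θ X = (Θ - Θ(0))* X` a.e.
  have h : IsCoanalytic fun t => star (Θ t) * X - star (fourierCoeff Θ 0) * X := by
    refine ⟨hsX.sub (memLp_const _), fun n hn => ?_⟩
    have e := fourierCoeff_clm ((ContinuousLinearMap.mul ℂ (E →L[ℂ] E)).flip X)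
      hs.integrable_two n
    simp only [ContinuousLinearMap.flip_apply, ContinuousLinearMap.mul_apply'] at e
    rw [fourierCoeff_sub' hsX.integrable_two (integrable_const _), e, fourierCoeff_const,
      fourierCoeff_star hΘ.analytic.memLp.integrable_two]
    split_ifs with h0
    · rw [h0, neg_zero, sub_self]
    · rw [hΘ.analytic.coeff _ (by omega), star_zero, zero_mul, sub_zero]
  refine h.congr ?_
  filter_upwards [hΘ.star_mul] with t ht
  rw [kernelFun, sub_mul, mul_sub, one_mul, mul_assoc, ← mul_assoc (star _) (Θ t), ht, one_mul]

lemma inModel_kernelFun_apply (hΘ : IsInnerFun Θ) (y : E) :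
    InModel Θ fun t => kernelFun Θ t y := by
  simpa using (inModelOp_kernelFun_mul hΘ 1).column y

lemma fourierCoeff_kernelFun_apply (hΘ : IsInnerFun Θ) (y : E) :
    fourierCoeff (fun t => kernelFun Θ t y) 0 =
      y - fourierCoeff Θ 0 (star (fourierCoeff Θ 0) y) := by
  have hc := memLp_column hΘ.analytic.memLp (star (fourierCoeff Θ 0) y)
  rw [← fourierCoeff_column hΘ.analytic.memLp.integrable_two]
  have := fourierCoeff_sub' (integrable_const y) hc.integrable_two 0
  rw [fourierCoeff_const, if_pos rfl] at this
  exact this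

/-- The backward shift `f ↦ z̄ (f - f(0))`. -/
noncomputable def backShift (f : Torus → E) (t : Torus) : E :=
  fourier (-1) t • (f t - fourierCoeff f 0)

lemma fourier_one_smul_backShift (f : Torus → E) (t : Torus) :
    fourier 1 t • backShift f t = f t - fourierCoeff f 0 := by
  rw [backShift, smul_smul, ← fourier_add, add_neg_cancel, fourier_zero, one_smul]

lemma memLp_top_backShift {f : Torus → E} (hf : MemLp f ∞ leb) : MemLp (backShift f) ∞ leb :=
  (hf.sub (memLp_const _)).fourier_smul (-1)

/-- `K_Θ` is invariant under the backward shift. -/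
lemma InModel.backShift {f : Torus → E} (hΘ : IsInnerFun Θ) (hf : InModel Θ f) :
    InModel Θ (backShift f) := by
  have hf2 := hf.analytic.memLp
  refine ⟨⟨(hf2.sub (memLp_const _)).fourier_smul (-1), fun n hn => ?_⟩, ?_⟩
  · unfold AsymTTO.backShift
    rw [fourierCoeff_fourier_smul, fourierCoeff_sub' hf2.integrable_two (integrable_const _),
      fourierCoeff_const]
    split_ifs with h0
    · rw [h0, sub_self]
    · rw [hf.analytic.coeff _ (by omega), sub_zero]
  · have hs := memLp_star hΘ.analytic.memLp
    have hc := memLp_column hs (fourierCoeff f 0)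
    have e : (fun t => star (Θ t) (AsymTTO.backShift f t)) = fun t => fourier (-1) t •
        (star (Θ t) (f t) - star (Θ t) (fourierCoeff f 0)) := by
      funext t
      rw [AsymTTO.backShift, map_smul, map_sub]
    rw [e]
    refine ⟨(hf.coanalytic.memLp.sub hc).fourier_smul (-1), fun n hn => ?_⟩
    rw [fourierCoeff_fourier_smul, fourierCoeff_sub' hf.coanalytic.memLp.integrable_two
      hc.integrable_two, hf.coanalytic.coeff _ (by omega), fourierCoeff_column hs.integrable_two,
      fourierCoeff_star hΘ.analytic.memLp.integrable_two, hΘ.analytic.coeff _ (by omega)]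
    simp

/-- The functions `z̄ (Θ - Θ(0)) x` belong to `K_Θ`. -/
lemma inModel_backShift_column (hΘ : IsInnerFun Θ) (x : E) :
    InModel Θ (backShift fun t => Θ t x) := by
  have hx := hΘ.isAnalytic_apply (isAnalytic_const x)
  have hx0 : fourierCoeff (fun t => Θ t x) 0 = fourierCoeff Θ 0 x :=
    fourierCoeff_column hΘ.analytic.memLp.integrable_two x 0
  have hs := memLp_star hΘ.analytic.memLp
  have hc := memLp_column hs (fourierCoeff Θ 0 x)
  refine ⟨⟨(hx.memLp.sub (memLp_const _)).fourier_smul (-1), fun n hn => ?_⟩, ?_⟩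
  · unfold backShift
    rw [fourierCoeff_fourier_smul, fourierCoeff_sub' hx.memLp.integrable_two (integrable_const _),
      fourierCoeff_const]
    split_ifs with h0
    · rw [h0, sub_self]
    · rw [hx.coeff _ (by omega), sub_zero]
  · have h : IsCoanalytic fun t => fourier (-1) t • (x - star (Θ t) (fourierCoeff Θ 0 x)) := by
      refine ⟨((memLp_const x).sub hc).fourier_smul (-1), fun n hn => ?_⟩
      rw [fourierCoeff_fourier_smul, fourierCoeff_sub' (integrable_const x) hc.integrable_two,
        fourierCoeff_const, if_neg (by omega), fourierCoeff_column hs.integrable_two,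
        fourierCoeff_star hΘ.analytic.memLp.integrable_two, hΘ.analytic.coeff _ (by omega)]
      simp
    refine h.congr ?_
    filter_upwards [hΘ.star_apply fun _ => x] with t ht
    rw [backShift, map_smul, map_sub, ht, hx0]

/-- A pure inner function has no constants in its range: if `Θ h` with `h ∈ H²` has no Fourier
coefficients of positive index then `h` is a constant `c` with `‖c‖ = ‖Θ(0) c‖`, so `h = 0`. -/
lemma IsInnerFun.apply_ae_eq_zero (hΘ : IsInnerFun Θ) (hp : ‖fourierCoeff Θ 0‖ < 1)
    {h : Torus → E} (hh : IsAnalytic h) (hd : ∀ n > 0, fourierCoeff (fun t => Θ t (h t)) n = 0) :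
    (fun t => Θ t (h t)) =ᵐ[leb] 0 := by
  have hΘh := hΘ.isAnalytic_apply hh
  have hpos n (hn : 0 < n) : fourierCoeff h n = 0 := by
    rw [← fourierCoeff_congr_ae (hΘ.star_apply h)]
    refine fourierCoeff_apply_eq_zero (memLp_star hΘ.analytic.memLp) hΘh.memLp fun k => ?_
    by_cases hk : 0 < k
    · exact .inr (hd k hk)
    · left
      rw [fourierCoeff_star hΘ.analytic.memLp.integrable_two, hΘ.analytic.coeff _ (by omega),
        star_zero]
  have hconst {g : Torus → E} (hg : MemLp g 2 leb) (h0 : ∀ n ≠ 0, fourierCoeff g n = 0) :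
      ∀ᵐ t ∂leb, g t = fourierCoeff g 0 := by
    have := ae_eq_zero_of_fourierCoeff (hg.sub (memLp_const (fourierCoeff g 0))) fun n => by
      refine (fourierCoeff_sub' hg.integrable_two (integrable_const _) n).trans ?_
      rw [fourierCoeff_const]
      split_ifs with hn
      · rw [hn, sub_self]
      · rw [h0 n hn, sub_zero]
    filter_upwards [this] with t ht
    exact sub_eq_zero.1 ht
  have h1 := hconst hh.memLp fun n hn => by
    rcases hn.lt_or_gt with hn | hn
    · exact hh.coeff n hn
    · exact hpos n hn
  have h2 := hconst hΘh.memLp fun n hn => by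
    rcases hn.lt_or_gt with hn | hn
    · exact hΘh.coeff n hn
    · exact hd n hn
  set c := fourierCoeff h 0
  have hb : fourierCoeff (fun t => Θ t (h t)) 0 = fourierCoeff Θ 0 c := by
    rw [← fourierCoeff_column hΘ.analytic.memLp.integrable_two]
    exact congrFun (fourierCoeff_congr_ae (h1.mono fun t ht => by simp only [ht])) 0
  rw [hb] at h2
  obtain ⟨t, t1, t2, t3⟩ := (h1.and (h2.and hΘ.star_mul)).exists
  have hn : ‖fourierCoeff Θ 0 c‖ = ‖c‖ := by
    rw [← t2, t1]
    exact (ContinuousLinearMap.norm_map_iff_adjoint_comp_self (Θ t)).2 t3 c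
  have hc : c = 0 := by
    by_contra hc
    have := (fourierCoeff Θ 0).le_opNorm c
    rw [hn] at this
    nlinarith [norm_pos_iff.2 hc]
  filter_upwards [h2] with t ht
  rw [ht, hc, map_zero]
  rfl

end Kernel

/-! ### Symbols of the zero operator -/

section ZeroSymbol

variable {E : Type*} [NormedAddCommGroup E] [InnerProductSpace ℂ E] [FiniteDimensional ℂ E]
  [CompleteSpace E] {U V : Torus → E →L[ℂ] E}

/-- `Φ` maps the bounded functions of `K_U` into `K_V^⊥`, that is, `A_Φ = 0`. -/
def KillsModel (U V Φ : Torus → E →L[ℂ] E) : Prop :=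
  ∀ f : Torus → E, MemLp f ∞ leb → InModel U f → PerpModel V fun t => Φ t (f t)

lemma KillsModel.congr {Φ Φ' : Torus → E →L[ℂ] E} (h : KillsModel U V Φ) (e : Φ =ᵐ[leb] Φ') :
    KillsModel U V Φ' :=
  fun f hf hfU => (h f hf hfU).congr (e.mono fun t ht => by simp only [ht])

lemma KillsModel.sub {Φ Φ' : Torus → E →L[ℂ] E} (h : KillsModel U V Φ)
    (h' : KillsModel U V Φ') : KillsModel U V fun t => Φ t - Φ' t := by
  intro f hf hfU
  exact (h f hf hfU).sub (h' f hf hfU)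

/-- Symbols in `V H² + (U H²)*` give the zero operator: `V F f ∈ V H²`, and `(U G)* f = G* (U* f)`
is coanalytic. -/
lemma killsModel_of_mem {F G : Torus → E →L[ℂ] E} (hU : IsInnerFun U) (hF : IsAnalytic F)
    (hG : IsAnalytic G) : KillsModel U V fun t => V t * F t + star (U t * G t) := by
  intro f hf hfU
  have h1 : MemLp (fun t => F t (f t)) 2 leb := memLp_apply hF.memLp hf
  have h2 : MemLp (fun t => star (U t) (f t)) ∞ leb := memLp_apply (memLp_star hU.memLp_top) hf
  refine ⟨_, hF.apply hfU.analytic h1, (hfU.coanalytic.star_apply hG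
    (memLp_apply (memLp_star hG.memLp) h2)).congr (ae_of_all _ fun t => ?_)⟩
  simp [star_mul]

/-- If `A_Φ = 0` and `f ∈ K_U` is bounded, subtracting from `Φ f ∈ K_V^⊥` the shift of
`Φ (backShift f) ∈ K_V^⊥` shows that `Φ f(0)` lies in `V H² + conj H²`. -/
lemma KillsModel.exists_apply_value {Φ : Torus → E →L[ℂ] E} (hU : IsInnerFun U)
    (h : KillsModel U V Φ) {f : Torus → E} (hf : MemLp f ∞ leb) (hfU : InModel U f) :
    ∃ p q d : Torus → E, IsAnalytic p ∧ IsAnalytic q ∧ IsCoanalytic d ∧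
      IsCoanalytic (fun t => Φ t (f t) - V t (p t)) ∧
      ∀ t, Φ t (fourierCoeff f 0) = V t (p t - fourier 1 t • q t) +
        ((Φ t (f t) - V t (p t)) - fourier 1 t • d t) := by
  obtain ⟨p, hp, hpc⟩ := h f hf hfU
  obtain ⟨q, hq, hqc⟩ := h _ (memLp_top_backShift hf) (hfU.backShift hU)
  refine ⟨p, q, _, hp, hq, hqc, hpc, fun t => ?_⟩
  rw [smul_sub, ← map_smul (Φ t), fourier_one_smul_backShift]
  simp only [map_sub, map_smul]
  abel

lemma fourierCoeff_star_column {χ : Torus → E →L[ℂ] E} (hχ : MemLp χ 2 leb) (x : E) (n : ℤ) :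
    fourierCoeff (fun t => star (χ t) x) n = star (fourierCoeff χ (-n)) x := by
  rw [fourierCoeff_column (memLp_star hχ).integrable_two, fourierCoeff_star hχ.integrable_two]

/-- If `A_{Ψ + χ*} = 0` then each column `Ψ x` is of the form `k₀^V w`: for a suitable constant `w`
the difference lies both in `K_V` and in `K_V^⊥`. -/
lemma exists_column_eq_kernelFun {Ψ χ : Torus → E →L[ℂ] E} (hU : IsInnerFun U)
    (hV : IsInnerFun V) (hpU : ‖fourierCoeff U 0‖ < 1) (hΨ : InModelOp V Ψ) (hχ : IsAnalytic χ)
    (h : KillsModel U V fun t => Ψ t + star (χ t)) (x : E) :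
    ∃ w, (fun t => Ψ t x) =ᵐ[leb] fun t => kernelFun V t w := by
  -- `f = k₀^U y` has value `(1 - U(0) U(0)*) y = x` at the origin
  obtain ⟨y, hy⟩ : ∃ y, y - fourierCoeff U 0 (star (fourierCoeff U 0) y) = x := by
    have hlt : ‖fourierCoeff U 0 * star (fourierCoeff U 0)‖ < 1 := by
      refine (norm_mul_le _ _).trans_lt ?_
      rw [norm_star]
      nlinarith [norm_nonneg (fourierCoeff U 0)]
    obtain ⟨u, hu⟩ := isUnit_one_sub_of_norm_lt_one hlt
    refine ⟨(↑u⁻¹ : E →L[ℂ] E) x, ?_⟩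
    have := congrArg (fun S : E →L[ℂ] E => S x) u.mul_inv
    rw [hu] at this
    exact this
  have hfU := inModel_kernelFun_apply hU y
  obtain ⟨p, q, d, hp, hq, hd, hpc, e⟩ := h.exists_apply_value hU
    (memLp_column (memLp_top_kernelFun hU) y) hfU
  rw [fourierCoeff_kernelFun_apply hU, hy] at e
  set c : Torus → E := fun t => (Ψ t + star (χ t)) (kernelFun U t y) - V t (p t)
  have hχx := memLp_column (memLp_star hχ.memLp) x
  have hzd := hd.memLp.fourier_smul 1
  -- `r = Ψ x - V (p - z q)` has no coefficients of positive index
  set r : Torus → E := fun t => c t - fourier 1 t • d t - star (χ t) x with hr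
  have hcz : MemLp (fun t => c t - fourier 1 t • d t) 2 leb := hpc.memLp.sub hzd
  have hrm : MemLp r 2 leb := hcz.sub hχx
  have hrc n (hn : 0 < n) : fourierCoeff r n = 0 := by
    rw [hr, fourierCoeff_sub' hcz.integrable_two hχx.integrable_two,
      fourierCoeff_sub' hpc.memLp.integrable_two hzd.integrable_two, hpc.coeff n hn.le,
      fourierCoeff_fourier_smul, hd.coeff _ (by omega), fourierCoeff_star_column hχ.memLp,
      hχ.coeff _ (by omega)]
    simp
  refine ⟨fourierCoeff r 0, ?_⟩
  have hm : InModel V fun t => Ψ t x - kernelFun V t (fourierCoeff r 0) := by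
    have h1 := hΨ.column x
    have h2 := inModel_kernelFun_apply hV (fourierCoeff r 0)
    exact ⟨h1.analytic.sub h2.analytic, by
      simpa only [map_sub] using h1.coanalytic.sub h2.coanalytic⟩
  have hperp : PerpModel V fun t => Ψ t x - kernelFun V t (fourierCoeff r 0) := by
    refine ⟨_, (hp.sub hq.shift).add (isAnalytic_const
      (star (fourierCoeff V 0) (fourierCoeff r 0))), ?_⟩
    have hco : IsCoanalytic fun t => r t - fourierCoeff r 0 := by
      refine ⟨hrm.sub (memLp_const _), fun n hn => ?_⟩
      rw [fourierCoeff_sub' hrm.integrable_two (integrable_const _), fourierCoeff_const]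
      split_ifs with h0
      · rw [h0, sub_self]
      · rw [hrc n (by omega), sub_zero]
    refine hco.congr (ae_of_all _ fun t => ?_)
    have et : Ψ t x = V t (p t - fourier 1 t • q t) + (c t - fourier 1 t • d t) -
        star (χ t) x := eq_sub_of_add_eq (e t)
    have hrt : r t = c t - fourier 1 t • d t - star (χ t) x := rfl
    have hk : kernelFun V t (fourierCoeff r 0) = fourierCoeff r 0 -
        V t (star (fourierCoeff V 0) (fourierCoeff r 0)) := rfl
    simp only [et, hk, map_add, hrt]
    abel
  filter_upwards [hm.ae_eq_zero hV hperp] with t ht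
  exact sub_eq_zero.1 ht

lemma exists_eq_kernelFun_mul {Ψ χ : Torus → E →L[ℂ] E} (hU : IsInnerFun U)
    (hV : IsInnerFun V) (hpU : ‖fourierCoeff U 0‖ < 1) (hΨ : InModelOp V Ψ) (hχ : IsAnalytic χ)
    (h : KillsModel U V fun t => Ψ t + star (χ t)) :
    ∃ X : E →L[ℂ] E, Ψ =ᵐ[leb] fun t => kernelFun V t * X := by
  choose w hw using exists_column_eq_kernelFun hU hV hpU hΨ hχ h
  let b := Module.finBasis ℂ E
  refine ⟨LinearMap.toContinuousLinearMap (b.constr ℂ fun i => w (b i)), ?_⟩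
  filter_upwards [ae_all_iff.2 fun i => hw (b i)] with t ht
  refine ContinuousLinearMap.coe_injective (b.ext fun i => ?_)
  refine (ht i).trans ?_
  change _ = kernelFun V t (b.constr ℂ (fun i => w (b i)) (b i))
  rw [b.constr_basis]

/-- If `A_{χ*} = 0` with `χ ∈ M_U` then `χ = 0`. By purity of `V` the coefficient of index `0` of
`χ* f` vanishes for each bounded `f ∈ K_U`; invariance under the backward shift gives the other
nonnegative indices, and the functions `z̄ (U - U(0)) x` then yield `χ* U = 0`. -/
lemma InModelOp.ae_eq_zero {χ : Torus → E →L[ℂ] E} (hU : IsInnerFun U) (hV : IsInnerFun V)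
    (hpV : ‖fourierCoeff V 0‖ < 1) (hχ : InModelOp U χ)
    (h : KillsModel U V fun t => star (χ t)) : χ =ᵐ[leb] 0 := by
  have hχs := memLp_star hχ.analytic.memLp
  have hχf {f : Torus → E} (hf : MemLp f ∞ leb) : MemLp (fun t => star (χ t) (f t)) 2 leb :=
    memLp_apply hχs hf
  have hcol (x : E) {n : ℤ} (hn : 0 < n) : fourierCoeff (fun t => star (χ t) x) n = 0 := by
    rw [fourierCoeff_star_column hχ.analytic.memLp, hχ.analytic.coeff _ (by omega)]
    simp
  have hzero {f : Torus → E} (hf : MemLp f ∞ leb) (hfU : InModel U f) :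
      fourierCoeff (fun t => star (χ t) (f t)) 0 = 0 := by
    obtain ⟨p, q, d, hp, hq, hd, hpc, e⟩ := h.exists_apply_value hU hf hfU
    have hk := hp.sub hq.shift
    have hx := memLp_column hχs (fourierCoeff f 0)
    have hzd := hd.memLp.fourier_smul 1
    have hcz : MemLp (fun t => (star (χ t) (f t) - V t (p t)) - fourier 1 t • d t) 2 leb :=
      hpc.memLp.sub hzd
    -- `V (p - z q)` is a constant, hence zero
    have h0 := hV.apply_ae_eq_zero hpV hk fun n hn => by
      have e' : (fun t => V t (p t - fourier 1 t • q t)) = fun t =>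
          star (χ t) (fourierCoeff f 0) -
            ((star (χ t) (f t) - V t (p t)) - fourier 1 t • d t) := by
        funext t; rw [e t, add_sub_cancel_right]
      rw [e', fourierCoeff_sub' hx.integrable_two hcz.integrable_two,
        fourierCoeff_sub' hpc.memLp.integrable_two hzd.integrable_two, hcol _ hn,
        hpc.coeff n hn.le, fourierCoeff_fourier_smul, hd.coeff _ (by omega)]
      simp
    -- so `χ* f - z V q` is coanalytic, and the coefficient of index `0` of `z V q` vanishes
    have hVq := hV.isAnalytic_apply hq
    have hzVq := hVq.memLp.fourier_smul 1
    have h1 : (fun t => star (χ t) (f t) - V t (p t)) =ᵐ[leb]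
        fun t => star (χ t) (f t) - fourier 1 t • V t (q t) := by
      filter_upwards [h0] with t ht
      rw [map_sub, map_smul, Pi.zero_apply, sub_eq_zero] at ht
      rw [ht]
    have h2 := (hpc.congr h1).coeff 0 le_rfl
    rwa [fourierCoeff_sub' (hχf hf).integrable_two hzVq.integrable_two,
      fourierCoeff_fourier_smul, hVq.coeff _ (by omega), sub_zero] at h2
  have hnat (m : ℕ) : ∀ f : Torus → E, MemLp f ∞ leb → InModel U f →
      fourierCoeff (fun t => star (χ t) (f t)) m = 0 := by
    induction m with
    | zero => exact fun f hf hfU => hzero hf hfU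
    | succ m ih =>
      intro f hf hfU
      have hs := ih _ (memLp_top_backShift hf) (hfU.backShift hU)
      have hx := memLp_column hχs (fourierCoeff f 0)
      simp only [backShift, map_smul, map_sub] at hs
      rw [fourierCoeff_fourier_smul, fourierCoeff_sub' (hχf hf).integrable_two hx.integrable_two,
        hcol _ (by omega), sub_zero] at hs
      rw [← hs]
      push_cast
      ring_nf
  have hUx (x : E) : (fun t => star (χ t) (U t x)) =ᵐ[leb] 0 := by
    have hUm := memLp_column hU.memLp_top x
    refine ae_eq_zero_of_fourierCoeff (hχf hUm) fun n => ?_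
    by_cases hn : 0 < n
    · obtain ⟨m, rfl⟩ : ∃ m : ℕ, n = m + 1 := ⟨(n - 1).toNat, by omega⟩
      have hs := hnat m _ (memLp_top_backShift hUm) (inModel_backShift_column hU x)
      have hx := memLp_column hχs (fourierCoeff (fun t => U t x) 0)
      simp only [backShift, map_smul, map_sub] at hs
      rw [fourierCoeff_fourier_smul, fourierCoeff_sub' (hχf hUm).integrable_two hx.integrable_two,
        hcol _ (by omega), sub_zero] at hs
      rw [← hs]
      ring_nf
    · have hc := hχ.coanalytic
      have e := fourierCoeff_star_column hc.memLp x n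
      rw [hc.coeff _ (by omega), star_zero, zero_apply] at e
      rw [← e]
      simp only [star_mul, star_star]
      rfl
  let b := Module.finBasis ℂ E
  filter_upwards [ae_all_iff.2 fun i => hUx (b i), hU.mul_star] with t ht hUt
  have h0 : star (χ t) * U t = 0 :=
    ContinuousLinearMap.coe_injective (b.ext fun i => ht i)
  have h1 : star (χ t) = 0 := by
    rw [← mul_one (star (χ t)), ← hUt, ← mul_assoc, h0, zero_mul]
  exact star_eq_zero.1 h1

/-- `A_{k₀^V X - (k₀^U X*)*} = 0`, because `k₀^V X - (k₀^U X*)* = -V V(0)* X + (U U(0)* X*)*`. -/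
lemma killsModel_kernelFun (hU : IsInnerFun U) (X : E →L[ℂ] E) :
    KillsModel U V fun t => kernelFun V t * X - star (kernelFun U t * star X) := by
  refine (killsModel_of_mem hU (isAnalytic_const (-(star (fourierCoeff V 0) * X)))
    (isAnalytic_const (star (fourierCoeff U 0) * star X))).congr (ae_of_all _ fun t => ?_)
  simp only [kernelFun, sub_mul, one_mul, star_sub, star_star, mul_neg, mul_assoc]
  abel

/-- The pairs of symbols in `M_V × M_U` of the zero operator. -/
lemma killsModel_iff {Ψ χ : Torus → E →L[ℂ] E} (hU : IsInnerFun U) (hV : IsInnerFun V)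
    (hpU : ‖fourierCoeff U 0‖ < 1) (hpV : ‖fourierCoeff V 0‖ < 1) :
    (InModelOp V Ψ ∧ InModelOp U χ ∧ KillsModel U V fun t => Ψ t + star (χ t)) ↔
      ∃ X : E →L[ℂ] E, (Ψ =ᵐ[leb] fun t => kernelFun V t * X) ∧
        χ =ᵐ[leb] fun t => -(kernelFun U t * star X) := by
  constructor
  · rintro ⟨hΨ, hχ, h⟩
    obtain ⟨X, hX⟩ := exists_eq_kernelFun_mul hU hV hpU hΨ hχ.analytic h
    refine ⟨X, hX, ?_⟩
    have h0 := (hχ.add (inModelOp_kernelFun_mul hU (star X))).ae_eq_zero hU hV hpV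
      ((h.sub (killsModel_kernelFun hU X)).congr ?_)
    · filter_upwards [h0] with t ht
      exact eq_neg_of_add_eq_zero_left ht
    · filter_upwards [hX] with t ht
      rw [ht, star_add]
      abel
  · rintro ⟨X, hΨ, hχ⟩
    refine ⟨(inModelOp_kernelFun_mul hV X).congr hΨ.symm, ?_,
      (killsModel_kernelFun hU X).congr ?_⟩
    · refine ((inModelOp_kernelFun_mul hU (-star X))).congr ?_
      filter_upwards [hχ] with t ht
      rw [ht, mul_neg]
    · filter_upwards [hΨ, hχ] with t h1 h2
      rw [h1, h2, star_neg, sub_eq_add_neg]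

/-- Modulo symbols of the zero operator, every `Φ ∈ L²` lies in `M_V + M_U*`: split `Φ` into its
analytic and coanalytic parts and remove from them the components in `V H²` and `(U H²)*`. -/
lemma exists_inModelOp_symbol (hU : IsInnerFun U) (hV : IsInnerFun V) {Φ : Torus → E →L[ℂ] E}
    (hΦ : MemLp Φ 2 leb) : ∃ Ψ χ, InModelOp V Ψ ∧ InModelOp U χ ∧
      KillsModel U V fun t => Ψ t + star (χ t) - Φ t := by
  obtain ⟨p, hp, hc⟩ := exists_analytic_add_coanalytic hΦ
  have hcs : IsAnalytic fun t => star (Φ t - p t) := ⟨memLp_star hc.memLp, fun n hn => by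
    rw [fourierCoeff_star hc.memLp.integrable_two, hc.coeff _ (by omega), star_zero]⟩
  have hB (S : E →L[ℂ] E) (hS : star S * S = 1) (w : E →L[ℂ] E) :
      ContinuousLinearMap.mul ℂ (E →L[ℂ] E) (star S)
        (ContinuousLinearMap.mul ℂ (E →L[ℂ] E) S w) = w := by
    simp only [ContinuousLinearMap.mul_apply']
    rw [← mul_assoc, hS, one_mul]
  obtain ⟨F, hF, h1, h2⟩ := hV.exists_decomposition (ContinuousLinearMap.mul ℂ _) hB hp
  obtain ⟨G, hG, h3, h4⟩ := hU.exists_decomposition (ContinuousLinearMap.mul ℂ _) hB hcs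
  refine ⟨_, _, ⟨h1, h2⟩, ⟨h3, h4⟩, ?_⟩
  have hF' : IsAnalytic fun t => -F t := hF.clm (-ContinuousLinearMap.id ℂ _)
  have hG' : IsAnalytic fun t => -G t := hG.clm (-ContinuousLinearMap.id ℂ _)
  refine (killsModel_of_mem hU hF' hG').congr (ae_of_all _ fun t => ?_)
  simp only [ContinuousLinearMap.mul_apply', star_sub, star_star, mul_neg, star_neg]
  abel

end ZeroSymbol

/-! ### From functions to `L²` classes -/

section Symbols

variable {E : Type*} [NormedAddCommGroup E] [InnerProductSpace ℂ E] [FiniteDimensional ℂ E]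
  [CompleteSpace E] {Θ₁ Θ₂ : LpT ∞ (E →L[ℂ] E)}

lemma coeFn_star (Ψ : LpT 2 (E →L[ℂ] E)) : ⇑(star Ψ) =ᵐ[leb] fun t => star (Ψ t) :=
  Lp.coeFn_star Ψ

lemma hasSymbol_zero_iff_killsModel (h₁ : IsInnerFun Θ₁) (h₂ : IsInnerFun Θ₂)
    {Φ : LpT 2 (E →L[ℂ] E)} {F : Torus → E →L[ℂ] E} (hF : Φ =ᵐ[leb] F) :
    HasSymbol Θ₁ Θ₂ 0 Φ ↔ KillsModel Θ₁ Θ₂ F :=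
  (hasSymbol_zero_iff h₁ h₂).trans
    ⟨fun h => KillsModel.congr h hF, fun h => KillsModel.congr h hF.symm⟩

lemma sub_ae_eq_iff {Ψ Ψ' K : LpT 2 (E →L[ℂ] E)} {k : Torus → E →L[ℂ] E} (hK : K =ᵐ[leb] k) :
    ((fun t => Ψ' t - Ψ t) =ᵐ[leb] k) ↔ Ψ' = Ψ + K := by
  rw [Lp.ext_iff]
  constructor
  · intro h
    filter_upwards [h, hK, Lp.coeFn_add Ψ K] with t h1 h2 h3
    rw [h3, Pi.add_apply, h2, ← h1, add_sub_cancel]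
  · intro h
    filter_upwards [h, hK, Lp.coeFn_add Ψ K] with t h1 h2 h3
    rw [h1, h3, Pi.add_apply, h2, add_sub_cancel_left]

lemma ae_eq_add_star (Ψ χ : LpT 2 (E →L[ℂ] E)) :
    ⇑(Ψ + star χ) =ᵐ[leb] fun t => Ψ t + star (χ t) := by
  filter_upwards [Lp.coeFn_add Ψ (star χ), coeFn_star χ] with t h1 h2
  rw [h1, Pi.add_apply, h2]

end Symbols

end AsymTTO

theorem mainTheorem4 {E : Type*} [NormedAddCommGroup E] [InnerProductSpace ℂ E]
    [FiniteDimensional ℂ E] [CompleteSpace E]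
    (Θ₁ Θ₂ : AsymTTO.LpT ∞ (E →L[ℂ] E))
    (hΘ₁ : AsymTTO.IsInner Θ₁) (hΘ₂ : AsymTTO.IsInner Θ₂)
    (hp₁ : AsymTTO.IsPure Θ₁) (hp₂ : AsymTTO.IsPure Θ₂)
    (A : AsymTTO.modelSpace Θ₁ →L[ℂ] AsymTTO.modelSpace Θ₂)
    (hA : A ∈ AsymTTO.asymTTO Θ₁ Θ₂) :
    (∃ Ψ₁ ∈ AsymTTO.symbolSpace Θ₂, ∃ Ψ₂ ∈ AsymTTO.symbolSpace Θ₁,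
      AsymTTO.HasSymbol Θ₁ Θ₂ A (Ψ₁ + star Ψ₂)) ∧
    ∀ Ψ₁ ∈ AsymTTO.symbolSpace Θ₂, ∀ Ψ₂ ∈ AsymTTO.symbolSpace Θ₁,
      AsymTTO.HasSymbol Θ₁ Θ₂ A (Ψ₁ + star Ψ₂) →
      ∀ Ψ₁' Ψ₂' : AsymTTO.LpT 2 (E →L[ℂ] E),
        (Ψ₁' ∈ AsymTTO.symbolSpace Θ₂ ∧ Ψ₂' ∈ AsymTTO.symbolSpace Θ₁ ∧
          AsymTTO.HasSymbol Θ₁ Θ₂ A (Ψ₁' + star Ψ₂')) ↔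
        ∃ X : E →L[ℂ] E, Ψ₁' = Ψ₁ + AsymTTO.kernelZeroMul Θ₂ X ∧
          Ψ₂' = Ψ₂ - AsymTTO.kernelZeroMul Θ₁ (star X) := by
  have h₁ := hΘ₁.isInnerFun
  have h₂ := hΘ₂.isInnerFun
  constructor
  · obtain ⟨Φ, hΦ⟩ := hA
    obtain ⟨Ψ, χ, hΨ, hχ, hk⟩ := AsymTTO.exists_inModelOp_symbol h₁ h₂ (Lp.memLp Φ)
    have eΨ := hΨ.analytic.memLp.coeFn_toLp
    have eχ := hχ.analytic.memLp.coeFn_toLp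
    refine ⟨hΨ.analytic.memLp.toLp _, (AsymTTO.mem_symbolSpace_iff h₂).2 (hΨ.congr eΨ.symm),
      hχ.analytic.memLp.toLp _, (AsymTTO.mem_symbolSpace_iff h₁).2 (hχ.congr eχ.symm), ?_⟩
    rw [hΦ.iff_sub]
    refine (AsymTTO.hasSymbol_zero_iff_killsModel h₁ h₂ ?_).2 hk
    filter_upwards [Lp.coeFn_sub (hΨ.analytic.memLp.toLp _ + star (hχ.analytic.memLp.toLp _)) Φ,
      AsymTTO.ae_eq_add_star (hΨ.analytic.memLp.toLp _) (hχ.analytic.memLp.toLp _), eΨ, eχ]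
      with t e1 e2 e3 e4
    rw [e1, Pi.sub_apply, e2, e3, e4]
  · intro Ψ₁ hΨ₁ Ψ₂ hΨ₂ hS Ψ₁' Ψ₂'
    rw [AsymTTO.mem_symbolSpace_iff h₂] at hΨ₁ ⊢
    rw [AsymTTO.mem_symbolSpace_iff h₁] at hΨ₂ ⊢
    have key := AsymTTO.killsModel_iff (Ψ := fun t => Ψ₁' t - Ψ₁ t)
      (χ := fun t => Ψ₂' t - Ψ₂ t) h₁ h₂ hp₁ hp₂
    have hm₁ : AsymTTO.InModelOp Θ₂ Ψ₁' ↔ AsymTTO.InModelOp Θ₂ fun t => Ψ₁' t - Ψ₁ t :=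
      ⟨fun h => h.sub hΨ₁, fun h => by simpa only [sub_add_cancel] using h.add hΨ₁⟩
    have hm₂ : AsymTTO.InModelOp Θ₁ Ψ₂' ↔ AsymTTO.InModelOp Θ₁ fun t => Ψ₂' t - Ψ₂ t :=
      ⟨fun h => h.sub hΨ₂, fun h => by simpa only [sub_add_cancel] using h.add hΨ₂⟩
    rw [hm₁, hm₂, hS.iff_sub, AsymTTO.hasSymbol_zero_iff_killsModel h₁ h₂
      (F := fun t => (Ψ₁' t - Ψ₁ t) + star (Ψ₂' t - Ψ₂ t)), key]
    · refine exists_congr fun X => and_congr ?_ ?_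
      · exact AsymTTO.sub_ae_eq_iff (AsymTTO.coeFn_kernelZeroMul Θ₂ X)
      · rw [sub_eq_add_neg]
        refine AsymTTO.sub_ae_eq_iff ?_
        filter_upwards [Lp.coeFn_neg (AsymTTO.kernelZeroMul Θ₁ (star X)),
          AsymTTO.coeFn_kernelZeroMul Θ₁ (star X)] with t e1 e2
        rw [e1, Pi.neg_apply, e2]
    · filter_upwards [Lp.coeFn_sub (Ψ₁' + star Ψ₂') (Ψ₁ + star Ψ₂),
        AsymTTO.ae_eq_add_star Ψ₁' Ψ₂', AsymTTO.ae_eq_add_star Ψ₁ Ψ₂] with t e1 e2 e3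
      rw [e1, Pi.sub_apply, e2, e3, star_sub]
      abel
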